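/- Let $d\in\mathbb N$ and let $\mathcal N$ be a family of norms on $\mathbb R^d$ for which there are two norms $\|\cdot\|_L,\|\cdot\|_U$ on $\mathbb R^d$ with $\|x\|_L\le\rho(x)\le\|x\|_U$ for all $\rho\in\mathcal N$ and $x\in\mathbb R^d$. Let $(k_n)$ be a sequence of natural numbers with $k_n\to\infty$ and $k_n/n\to 0$. Then $k_n$-nearest neighbour classification with any sequence of random norms $\rho_n\in\mathcal N$ that are independent of the sample and of the query is universally consistent, that is: Let $\mu$ be any Borel probability measure on $\mathbb R^d\times\{0,1\}$, let $(X_1,Y_1),(X_2,Y_2),\dots$ and $(X,Y)$ be independent random pairs with distribution $\mu$, put $D_n=((X_1,Y_1),\dots,(X_n,Y_n))$, let $U_1,U_2,\dots$ be independent random variables with the uniform distribution on $[0,1]$ (the tie-breakers), and for each $n$ let $\rho_n$ be a random element of $\mathcal N$ (so that $\rho_n(x)$ is a random variable for every $x\in\mathbb R^d$), such that for each $n$ the pair $(\rho_n,(U_1,\dots,U_n))$ is independent of $(D_n,(X,Y))$. Order the indices $1,\dots,n$ by increasing distance $\rho_n(X_i-X)$, where among indices with equal distance the one with the larger $U_i$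 comes first; let $W_{ni}=1/k_n$ if fewer than $k_n$ indices come before $i$, and $W_{ni}=0$ otherwise. Let the predicted label be $g_n=1$ if $\sum_{i=1}^n W_{ni}Y_i\ge 1/2$ and $g_n=0$ otherwise. Let $\ell^*(\mu)=\inf_g \mu\{(x,y): g(x)\ne y\}$ be the Bayes error, the infimum being over all Borel functions $g:\mathbb R^d\to\{0,1\}$. Then, as $n\to\infty$, the conditional error probability $L_n=\mathbb P(g_n\ne Y\mid D_n)$ converges to $\ell^*(\mu)$ in probability, and $\mathbb P(g_n\ne Y)\to\ell^*(\mu)$. -/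

import Mathlib

open MeasureTheory ProbabilityTheory Filter Topology

noncomputable section

namespace KNN

/-- A norm on a real vector space: a seminorm that vanishes only at zero. The order `p ≤ q` on
seminorms is the pointwise one, `p x ≤ q x` for all `x`. -/
def IsNorm {E : Type*} [AddCommGroup E] [Module ℝ E] (p : Seminorm ℝ E) : Prop :=
  ∀ x : E, p x = 0 → x = 0

/-- The misclassification error of a classifier `g` for the distribution `μ` of (point, label). -/
def misclassificationError {E : Type*} [MeasurableSpace E] (μ : Measure (E × Fin 2))
    (g : E → Fin 2) : ℝ :=
  μ.real {z | g z.1 ≠ z.2}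

/-- The Bayes error: the infimum of the misclassification errors of all measurable classifiers. -/
def bayesError {E : Type*} [MeasurableSpace E] (μ : Measure (E × Fin 2)) : ℝ :=
  sInf {e : ℝ | ∃ g : E → Fin 2, Measurable g ∧ e = misclassificationError μ g}

/-- The `j`-th sample point precedes the `i`-th one in the order of increasing `ρ`-distance from
the query `x`; a distance tie is won by the point with the larger tie-breaker `u`. -/
def Precedes {d n : ℕ} (ρ : Seminorm ℝ (Fin d → ℝ)) (u : Fin n → ℝ)
    (xs : Fin n → Fin d → ℝ) (x : Fin d → ℝ) (j i : Fin n) : Prop :=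
  ρ (xs j - x) < ρ (xs i - x) ∨ (ρ (xs j - x) = ρ (xs i - x) ∧ u i < u j)

/-- The `i`-th sample point is one of the `k` nearest neighbours of `x`: fewer than `k` sample
points precede it. -/
def IsNearestNeighbour {d n : ℕ} (k : ℕ) (ρ : Seminorm ℝ (Fin d → ℝ)) (u : Fin n → ℝ)
    (xs : Fin n → Fin d → ℝ) (x : Fin d → ℝ) (i : Fin n) : Prop :=
  {j : Fin n | Precedes ρ u xs x j i}.ncard < k

open Classical in
/-- The weights of the `k`-nearest neighbour rule. -/
def knnWeight {d n : ℕ} (k : ℕ) (ρ : Seminorm ℝ (Fin d → ℝ)) (u : Fin n → ℝ)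
    (xs : Fin n → Fin d → ℝ) (x : Fin d → ℝ) (i : Fin n) : ℝ :=
  if IsNearestNeighbour k ρ u xs x i then 1 / (k : ℝ) else 0

/-- The estimate of the regression function at `x` computed from the labelled sample `D`. -/
def knnRegression {d n : ℕ} (k : ℕ) (ρ : Seminorm ℝ (Fin d → ℝ)) (u : Fin n → ℝ)
    (D : Fin n → (Fin d → ℝ) × Fin 2) (x : Fin d → ℝ) : ℝ :=
  ∑ i, (((D i).2 : ℕ) : ℝ) * knnWeight k ρ u (fun j => (D j).1) x i

open Classical in
/-- The label that `k`-NN with the norm `ρ`, the tie-breakers `u` and the labelled sample `D`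
predicts for the query `x`; a voting tie is resolved in favour of the label `1`. -/
def knnClassifier {d n : ℕ} (k : ℕ) (ρ : Seminorm ℝ (Fin d → ℝ)) (u : Fin n → ℝ)
    (D : Fin n → (Fin d → ℝ) × Fin 2) (x : Fin d → ℝ) : Fin 2 :=
  if 1 / 2 ≤ knnRegression k ρ u D x then 1 else 0

/-- Consistency for `μ` of the predictions `pred n` made from the samples `D n` for the query `Q`:
the conditional error probability `L n = P(pred n ≠ Y | D n)` converges in probability to the
Bayes error, and the unconditional error probability `P(pred n ≠ Y)` converges to it. -/
def IsConsistent {Ω E : Type*} [MeasurableSpace Ω] [MeasurableSpace E] (P : Measure Ω)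
    (μ : Measure (E × Fin 2)) (D : ∀ n : ℕ, Ω → Fin n → E × Fin 2) (Q : Ω → E × Fin 2)
    (pred : ℕ → Ω → Fin 2) : Prop :=
  TendstoInMeasure P
      (fun n => P[{ω | pred n ω ≠ (Q ω).2}.indicator (fun _ => (1 : ℝ)) |
        MeasurableSpace.comap (D n) inferInstance])
      atTop (fun _ => bayesError μ) ∧
    Tendsto (fun n => P.real {ω | pred n ω ≠ (Q ω).2}) atTop (𝓝 (bayesError μ))

end KNN

end

/-!
Universal consistency of the nearest neighbour rule with random norms.

By independence and Fubini, the norm and the tie-breakers may be frozen: it suffices to bound the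
error probability of the rule for a fixed norm `ρ` with `c‖x‖ ≤ ρ x ≤ C‖x‖` and fixed distinct
tie-breakers, uniformly over all of these (`KNN.eventually_measure_knnClassifier_ne_le`). The
constants `c` and `C` are supplied by the two norms that sandwich the family
(`KNN.exists_norm_equiv`), and continuous tie-breakers are almost surely distinct.

For the frozen rule this is Stone's argument. The excess error of a plug-in classifier is at most
twice the mean absolute error of the regression estimate `∑ wᵢ Yᵢ`, which splits into a noise term
`∑ wᵢ (Yᵢ - η Xᵢ)` and a bias term `∑ wᵢ (η Xᵢ - η X)`. The noise has second moment at most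
`max wᵢ = 1 / k`, because the residuals of different labels are orthogonal
(`KNN.integral_sq_sum_residual_le`). In the bias `η` is replaced by a compactly supported
continuous `g`. The cost at the neighbours is controlled by
`E ∑ wᵢ f(Xᵢ) ≤ m E f(X)` (`KNN.lintegral_sum_knnWeight_mul_le`). This follows by exchanging the
query with each sample point and using that it then becomes a `k` nearest neighbour of at
most `m * k` of them, where `m - 1` narrow cones cover the space
(`KNN.exists_card_isNearestNeighbour_update_le`); `m` depends on `c` and `C` only, hence the
uniformity. The oscillation of `g` over the neighbours is small unless fewer than `k` sample points
lie in a small ball around the query, an event whose probability tends to `0` by a Chernoff bound,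
since `k / n → 0` and almost every query lies in the support of the distribution.

The conditional error probabilities are almost surely at least the Bayes error
(`KNN.bayesError_le_condExp`), so the convergence of their means to the Bayes error already gives
convergence in probability.
-/

noncomputable section

namespace KNN

/-! ### Norms on a finite-dimensional space -/

theorem exists_seminorm_le_mul_norm {d : ℕ} (p : Seminorm ℝ (Fin d → ℝ)) :
    ∃ C : ℝ, 0 < C ∧ ∀ x, p x ≤ C * ‖x‖ := by
  refine ⟨1 + ∑ i, p (Pi.single i 1), by positivity, fun x => ?_⟩
  calc p x = p (∑ i, x i • (Pi.single i 1 : Fin d → ℝ)) := by rw [← pi_eq_sum_univ' x]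
    _ ≤ ∑ i, p (x i • (Pi.single i 1 : Fin d → ℝ)) :=
        Finset.le_sum_of_subadditive p (map_zero p).le (map_add_le_add p) _ _
    _ ≤ ∑ i, p (Pi.single i 1) * ‖x‖ := by
        refine Finset.sum_le_sum fun i _ => ?_
        rw [map_smul_eq_mul, mul_comm]
        exact mul_le_mul_of_nonneg_left (norm_le_pi_norm x i) (apply_nonneg p _)
    _ ≤ (1 + ∑ i, p (Pi.single i 1)) * ‖x‖ := by
        rw [← Finset.sum_mul]
        exact mul_le_mul_of_nonneg_right (by linarith) (norm_nonneg x)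

theorem continuous_of_le_mul_norm {d : ℕ} {p : Seminorm ℝ (Fin d → ℝ)} {C : ℝ}
    (h : ∀ x, p x ≤ C * ‖x‖) : Continuous p := by
  have h' : p ≤ C.toNNReal • normSeminorm ℝ (Fin d → ℝ) := fun x => by
    refine (h x).trans ?_
    change C * ‖x‖ ≤ (C.toNNReal : ℝ) * ‖x‖
    exact mul_le_mul_of_nonneg_right (Real.le_coe_toNNReal C) (norm_nonneg x)
  refine Seminorm.continuous_of_le ?_ h'
  change Continuous fun x : Fin d → ℝ => (C.toNNReal : ℝ) * ‖x‖
  fun_prop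

theorem continuous_seminorm {d : ℕ} (p : Seminorm ℝ (Fin d → ℝ)) : Continuous p := by
  obtain ⟨C, -, hC⟩ := exists_seminorm_le_mul_norm p
  exact continuous_of_le_mul_norm hC

theorem IsNorm.exists_mul_norm_le {d : ℕ} {p : Seminorm ℝ (Fin d → ℝ)} (hp : IsNorm p) :
    ∃ c : ℝ, 0 < c ∧ ∀ x, c * ‖x‖ ≤ p x := by
  rcases (Metric.sphere (0 : Fin d → ℝ) 1).eq_empty_or_nonempty with he | hne
  · refine ⟨1, one_pos, fun x => ?_⟩
    have hx : x = 0 := by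
      by_contra hx
      have : (‖x‖⁻¹ • x) ∈ Metric.sphere (0 : Fin d → ℝ) 1 := by
        simp [norm_smul, hx]
      simp [he] at this
    simp [hx]
  · obtain ⟨z, hz, hmin⟩ := (isCompact_sphere (0 : Fin d → ℝ) 1).exists_isMinOn hne
      (continuous_seminorm p).continuousOn
    have hz1 : ‖z‖ = 1 := by simpa using hz
    have hz0 : z ≠ 0 := by rintro rfl; simp at hz1
    refine ⟨p z, (apply_nonneg p z).lt_of_ne' fun h => hz0 (hp z h), fun x => ?_⟩
    by_cases hx : x = 0
    · simp [hx]
    have hx' : 0 < ‖x‖ := norm_pos_iff.2 hx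
    have h1 : p z ≤ p (‖x‖⁻¹ • x) := hmin (by simp [norm_smul, hx])
    rw [map_smul_eq_mul, norm_inv, norm_norm, inv_mul_eq_div, le_div_iff₀ hx'] at h1
    exact h1

/-- A family of seminorms sandwiched between two norms is uniformly equivalent to the ambient
norm. -/
theorem exists_norm_equiv {d : ℕ} {𝒩 : Set (Seminorm ℝ (Fin d → ℝ))}
    (h : ∃ L U : Seminorm ℝ (Fin d → ℝ), IsNorm L ∧ IsNorm U ∧ ∀ ρ ∈ 𝒩, L ≤ ρ ∧ ρ ≤ U) :
    ∃ c C : ℝ, 0 < c ∧ 0 < C ∧ ∀ ρ ∈ 𝒩, ∀ x, c * ‖x‖ ≤ ρ x ∧ ρ x ≤ C * ‖x‖ := by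
  obtain ⟨L, U, hL, -, hLU⟩ := h
  obtain ⟨c, hc, hcL⟩ := hL.exists_mul_norm_le
  obtain ⟨C, hC, hCU⟩ := exists_seminorm_le_mul_norm U
  exact ⟨c, C, hc, hC, fun ρ hρ x =>
    ⟨(hcL x).trans ((hLU ρ hρ).1 x), ((hLU ρ hρ).2 x).trans (hCU x)⟩⟩

/-! ### Counting nearest neighbours -/

section Counting

variable {d n : ℕ} {k : ℕ} {ρ : Seminorm ℝ (Fin d → ℝ)} {u : Fin n → ℝ}
  {xs : Fin n → Fin d → ℝ} {x : Fin d → ℝ}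

theorem Precedes.trans {a b c : Fin n} (h₁ : Precedes ρ u xs x a b)
    (h₂ : Precedes ρ u xs x b c) : Precedes ρ u xs x a c := by
  unfold Precedes at *
  rcases h₁ with h₁ | ⟨h₁, h₁'⟩ <;> rcases h₂ with h₂ | ⟨h₂, h₂'⟩
  · exact Or.inl (h₁.trans h₂)
  · exact Or.inl (h₂ ▸ h₁)
  · exact Or.inl (h₁ ▸ h₂)
  · exact Or.inr ⟨h₁.trans h₂, h₂'.trans h₁'⟩

theorem not_precedes_self (i : Fin n) : ¬ Precedes ρ u xs x i i := by
  simp [Precedes]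

theorem precedes_or_precedes (hu : Function.Injective u) {i j : Fin n} (hij : i ≠ j) :
    Precedes ρ u xs x i j ∨ Precedes ρ u xs x j i := by
  unfold Precedes
  rcases lt_trichotomy (ρ (xs i - x)) (ρ (xs j - x)) with h | h | h
  · exact Or.inl (Or.inl h)
  · rcases lt_or_gt_of_ne (hu.ne hij) with h' | h'
    · exact Or.inr (Or.inr ⟨h.symm, h'⟩)
    · exact Or.inl (Or.inr ⟨h, h'⟩)
  · exact Or.inr (Or.inl h)

theorem ncard_precedes_lt (i : Fin n) : {j | Precedes ρ u xs x j i}.ncard < n := by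
  have h : {j | Precedes ρ u xs x j i} ⊂ Set.univ :=
    (Set.ssubset_univ_iff).2 fun h => not_precedes_self i (h.symm ▸ Set.mem_univ i :
      i ∈ {j | Precedes ρ u xs x j i})
  simpa [Set.ncard_univ] using Set.ncard_lt_ncard h

/-- With distinct tie-breakers the order is total, so the ranks of the sample points are
`0, …, n - 1`, each attained once, and exactly `k` points are `k` nearest neighbours. -/
theorem ncard_isNearestNeighbour (hu : Function.Injective u) (hk : k ≤ n) :
    {i | IsNearestNeighbour k ρ u xs x i}.ncard = k := by
  let rank : Fin n → Fin n := fun i => ⟨{j | Precedes ρ u xs x j i}.ncard, ncard_precedes_lt i⟩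
  have hlt : ∀ i j, Precedes ρ u xs x i j → rank i < rank j := fun i j hij =>
    Set.ncard_lt_ncard ((Set.ssubset_iff_of_subset fun a ha => Precedes.trans ha hij).2
      ⟨i, hij, not_precedes_self i⟩)
  have hinj : Function.Injective rank := fun i j h => by
    by_contra hij
    rcases precedes_or_precedes (ρ := ρ) (xs := xs) (x := x) hu hij with h' | h'
    · exact (hlt _ _ h').ne h
    · exact (hlt _ _ h').ne' h
  have hset : {i | IsNearestNeighbour k ρ u xs x i} = rank ⁻¹' {m | (m : ℕ) < k} := rfl
  rw [hset, Set.ncard_preimage_of_injective_subset_range hinj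
    (by rw [(Finite.injective_iff_surjective.1 hinj).range_eq]; exact Set.subset_univ _),
    Set.ncard_eq_toFinset_card']
  simp [Fin.card_filter_val_lt, hk]

theorem knnWeight_nonneg (i : Fin n) : 0 ≤ knnWeight k ρ u xs x i := by
  unfold knnWeight; split_ifs <;> positivity

theorem knnWeight_le (i : Fin n) : knnWeight k ρ u xs x i ≤ 1 / (k : ℝ) := by
  unfold knnWeight; split_ifs
  · exact le_rfl
  · positivity

theorem sum_knnWeight (hu : Function.Injective u) (hk₀ : 0 < k) (hk : k ≤ n) :
    ∑ i, knnWeight k ρ u xs x i = 1 := by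
  classical
  have h := ncard_isNearestNeighbour (ρ := ρ) (xs := xs) (x := x) hu hk
  rw [Set.ncard_eq_toFinset_card', Set.toFinset_ofPred] at h
  unfold knnWeight
  rw [Finset.sum_ite, Finset.sum_const_zero, add_zero, Finset.sum_const, nsmul_eq_mul]
  have hk' : (k : ℝ) ≠ 0 := by positivity
  have : ((Finset.univ.filter fun i => IsNearestNeighbour k ρ u xs x i).card : ℝ) = k := by
    rw [← h]; congr!
  rw [this]; field_simp

/-- If at least `k` sample points lie within `ρ`-distance `a` of the query, then so does every
point with a positive weight. -/
theorem dist_le_of_knnWeight_ne_zero {a : ℝ} (hk : k ≤ {j | ρ (xs j - x) ≤ a}.ncard) {i : Fin n}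
    (hi : knnWeight k ρ u xs x i ≠ 0) : ρ (xs i - x) ≤ a := by
  by_contra! h
  have hnn : IsNearestNeighbour k ρ u xs x i := by
    by_contra hn; exact hi (by simp [knnWeight, hn])
  have : {j | ρ (xs j - x) ≤ a} ⊆ {j | Precedes ρ u xs x j i} := fun j hj =>
    Or.inl (lt_of_le_of_lt hj h)
  exact absurd (Set.ncard_le_ncard this) (by unfold IsNearestNeighbour at hnn; omega)

/-- If all other members of `S` precede one of its members that is a `k` nearest neighbour, then
`S` has at most `k` members. -/
theorem card_le_of_forall_precedes {S : Finset (Fin n)} {i : Fin n} (hi : i ∈ S)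
    (hnn : IsNearestNeighbour k ρ u xs x i)
    (h : ∀ j ∈ S, j ≠ i → Precedes ρ u xs x j i) : S.card ≤ k := by
  classical
  have hsub : (↑(S.erase i) : Set (Fin n)) ⊆ {j | Precedes ρ u xs x j i} := fun j hj => by
    have hj' := Finset.mem_erase.1 (Finset.mem_coe.1 hj)
    exact h j hj'.2 hj'.1
  have h1 := Set.ncard_le_ncard hsub
  rw [Set.ncard_coe_finset, Finset.card_erase_of_mem hi] at h1
  unfold IsNearestNeighbour at hnn
  omega

/-- Two vectors in a common narrow cone: the shorter one, if it is not zero, is closer to the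
longer one than the origin is. -/
theorem seminorm_sub_lt_of_directions_close {p : Seminorm ℝ (Fin d → ℝ)} {y z : Fin d → ℝ}
    (hy : 0 < p y) (hyz : p y ≤ p z) (h : p ((p z)⁻¹ • z - (p y)⁻¹ • y) < 1) :
    p (z - y) < p z := by
  have hz : 0 < p z := hy.trans_le hyz
  have hdec : z - y = ((p z - p y) * (p z)⁻¹) • z + p y • ((p z)⁻¹ • z - (p y)⁻¹ • y) := by
    rw [smul_sub, smul_smul, smul_smul, mul_inv_cancel₀ hy.ne', one_smul, sub_mul,
      mul_inv_cancel₀ hz.ne', sub_smul, one_smul]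
    abel
  calc p (z - y) ≤ p (((p z - p y) * (p z)⁻¹) • z) +
        p (p y • ((p z)⁻¹ • z - (p y)⁻¹ • y)) := by
          conv_lhs => rw [hdec]
          exact map_add_le_add p _ _
    _ = (p z - p y) + p y * p ((p z)⁻¹ • z - (p y)⁻¹ • y) := by
          rw [map_smul_eq_mul, map_smul_eq_mul, Real.norm_of_nonneg, Real.norm_of_nonneg hy.le,
            mul_assoc, inv_mul_cancel₀ hz.ne', mul_one]
          exact mul_nonneg (sub_nonneg.2 hyz) (inv_nonneg.2 hz.le)
    _ < (p z - p y) + p y * 1 := by gcongr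
    _ = p z := by ring

/-- Stone's lemma: exchanging the query `x` with the sample points one at a time, `x` becomes a
`k` nearest neighbour of at most `m * k` sample points, with `m` depending only on the constants
of equivalence of the norm. The directions are covered by finitely many narrow cones; among the
sample points in one of the cones with apex `x`, the farthest from `x` is strictly closer to all
the others than to `x`, hence there are at most `k` of them. Sample points that coincide with `x`
are counted separately, with the help of the tie-breakers. -/
theorem exists_card_isNearestNeighbour_update_le (d : ℕ) {c C : ℝ} (hc : 0 < c) (hC : 0 < C) :
    ∃ m : ℕ, ∀ ρ : Seminorm ℝ (Fin d → ℝ), (∀ x, c * ‖x‖ ≤ ρ x ∧ ρ x ≤ C * ‖x‖) →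
      ∀ (n k : ℕ) (u : Fin n → ℝ), Function.Injective u → ∀ (xs : Fin n → Fin d → ℝ)
        (x : Fin d → ℝ),
        {i | IsNearestNeighbour k ρ u (Function.update xs i x) (xs i) i}.ncard ≤ m * k := by
  classical
  have htb : TotallyBounded (Metric.closedBall (0 : Fin d → ℝ) c⁻¹) :=
    (isCompact_closedBall _ _).totallyBounded
  obtain ⟨t, htfin, ht⟩ := Metric.totallyBounded_iff.1 htb (1 / (2 * C)) (by positivity)
  have hcol : ∀ y : Fin d → ℝ, ∃ z, ‖y‖ ≤ c⁻¹ → z ∈ t ∧ dist y z < 1 / (2 * C) := fun y => by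
    by_cases hy : ‖y‖ ≤ c⁻¹
    · have := ht (show y ∈ Metric.closedBall (0 : Fin d → ℝ) c⁻¹ by simpa using hy)
      simp only [Set.mem_iUnion, Metric.mem_ball, exists_prop] at this
      obtain ⟨z, hz⟩ := this
      exact ⟨z, fun _ => hz⟩
    · exact ⟨0, fun h => absurd h hy⟩
  choose κ hκ using hcol
  refine ⟨htfin.toFinset.card + 1, fun ρ hρ n k u hu xs x => ?_⟩
  have hpos : ∀ y, y ≠ 0 → 0 < ρ y := fun y hy =>
    (mul_pos hc (norm_pos_iff.2 hy)).trans_le (hρ y).1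
  have hdir : ∀ y, y ≠ 0 → ‖(ρ y)⁻¹ • y‖ ≤ c⁻¹ := fun y hy => by
    have h := (hρ ((ρ y)⁻¹ • y)).1
    rw [map_smul_eq_mul, Real.norm_of_nonneg (inv_nonneg.2 (hpos y hy).le),
      inv_mul_cancel₀ (hpos y hy).ne'] at h
    exact ((le_inv_mul_iff₀ hc).2 h).trans_eq (mul_one _)
  set S : Finset (Fin n) := Finset.univ.filter
    fun i => IsNearestNeighbour k ρ u (Function.update xs i x) (xs i) i with hS
  have hcard : {i | IsNearestNeighbour k ρ u (Function.update xs i x) (xs i) i}.ncard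
      = S.card := by
    rw [← Set.ncard_coe_finset, hS]; congr 1; ext i; simp
  rw [hcard, ← Finset.card_filter_add_card_filter_not (s := S) (fun i => xs i = x), add_mul,
    one_mul, add_comm]
  refine add_le_add ?_ ?_
  · -- the sample points different from `x`, cone by cone
    rw [mul_comm]
    refine Finset.card_le_mul_card_image_of_maps_to
      (f := fun i => κ ((ρ (xs i - x))⁻¹ • (xs i - x))) (fun i hi => ?_) k fun b _ => ?_
    · have hi' := (Finset.mem_filter.1 hi).2
      exact htfin.mem_toFinset.2 (hκ _ (hdir _ (sub_ne_zero.2 hi'))).1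
    · -- all other points of a cone precede the one farthest from `x`
      set F := (S.filter fun i => ¬ xs i = x).filter
        fun i => κ ((ρ (xs i - x))⁻¹ • (xs i - x)) = b with hF
      rcases F.eq_empty_or_nonempty with he | hne
      · simp [he]
      obtain ⟨i, hi, hmax⟩ := F.exists_max_image (fun i => ρ (xs i - x)) hne
      have hmem : ∀ j ∈ F, xs j - x ≠ 0 ∧ κ ((ρ (xs j - x))⁻¹ • (xs j - x)) = b := fun j hj =>
        ⟨sub_ne_zero.2 (Finset.mem_filter.1 (Finset.mem_filter.1 hj).1).2,
          (Finset.mem_filter.1 hj).2⟩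
      have hiS : i ∈ S := (Finset.mem_filter.1 (Finset.mem_filter.1 hi).1).1
      refine card_le_of_forall_precedes hi (Finset.mem_filter.1 hiS).2 fun j hj hji => Or.inl ?_
      rw [Function.update_of_ne hji, Function.update_self]
      obtain ⟨hi0, hib⟩ := hmem i hi
      obtain ⟨hj0, hjb⟩ := hmem j hj
      have h1 := (hκ _ (hdir _ hi0)).2
      have h2 := (hκ _ (hdir _ hj0)).2
      rw [hib] at h1
      rw [hjb] at h2
      have hclose : ρ ((ρ (xs i - x))⁻¹ • (xs i - x) - (ρ (xs j - x))⁻¹ • (xs j - x)) < 1 := by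
        refine ((hρ _).2).trans_lt ?_
        rw [← dist_eq_norm]
        calc C * dist _ _ < C * (1 / (2 * C) + 1 / (2 * C)) :=
              mul_lt_mul_of_pos_left ((dist_triangle_right _ _ b).trans_lt (add_lt_add h1 h2)) hC
          _ = 1 := by field_simp; norm_num
      have h3 := seminorm_sub_lt_of_directions_close (hpos _ hj0) (hmax j hj) hclose
      rw [sub_sub_sub_cancel_right] at h3
      rwa [map_sub_rev, map_sub_rev ρ x]
  · -- the sample points equal to `x`: all others precede the one with the smallest tie-breaker
    rcases (S.filter fun i => xs i = x).eq_empty_or_nonempty with he | hne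
    · simp [he]
    obtain ⟨i, hi, hmin⟩ := (S.filter fun i => xs i = x).exists_min_image u hne
    have hi' := Finset.mem_filter.1 hi
    refine card_le_of_forall_precedes hi (Finset.mem_filter.1 hi'.1).2
      fun j hj hji => Or.inr ⟨?_, (hmin j hj).lt_of_ne (hu.ne hji.symm)⟩
    rw [Function.update_of_ne hji, Function.update_self, (Finset.mem_filter.1 hj).2]

theorem sum_knnWeight_update_le {m : ℕ}
    (h : {i | IsNearestNeighbour k ρ u (Function.update xs i x) (xs i) i}.ncard ≤ m * k) :
    ∑ i, knnWeight k ρ u (Function.update xs i x) (xs i) i ≤ m := by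
  classical
  rw [Set.ncard_eq_toFinset_card', Set.toFinset_ofPred] at h
  unfold knnWeight
  rw [Finset.sum_ite, Finset.sum_const_zero, add_zero, Finset.sum_const, nsmul_eq_mul, mul_one_div]
  refine div_le_of_le_mul₀ (by positivity) (by positivity) ?_
  have h' : ((Finset.univ.filter fun i => IsNearestNeighbour k ρ u (Function.update xs i x)
    (xs i) i).card : ℝ) ≤ ((m * k : ℕ) : ℝ) := Nat.cast_le.2 (le_trans (le_of_eq (by congr!)) h)
  push_cast at h'
  exact h'

end Counting

/-! ### Measurability of the rule -/

section Measurability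

variable {d n k : ℕ} {S : Type*} [MeasurableSpace S] {R : S → Seminorm ℝ (Fin d → ℝ)}
  {u : S → Fin n → ℝ} {xs : S → Fin n → Fin d → ℝ} {x : S → Fin d → ℝ}

/-- Seminorms on a finite-dimensional space are continuous, so a random seminorm with measurable
values at fixed points also has measurable values at random points. -/
theorem measurable_seminorm_apply (hR : ∀ y, Measurable fun s => R s y) (hx : Measurable x) :
    Measurable fun s => R s (x s) := by
  have h := measurable_uncurry_of_continuous_of_measurable
    (u := fun (y : Fin d → ℝ) (s : S) => R s y) (fun s => continuous_seminorm (R s)) hR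
  exact h.comp (hx.prodMk measurable_id)

theorem measurableSet_precedes (hR : ∀ y, Measurable fun s => R s y) (hu : Measurable u)
    (hxs : Measurable xs) (hx : Measurable x) (j i : Fin n) :
    MeasurableSet {s | Precedes (R s) (u s) (xs s) (x s) j i} := by
  have hd : ∀ i, Measurable fun s => R s (xs s i - x s) := fun i =>
    measurable_seminorm_apply hR (((measurable_pi_apply i).comp hxs).sub hx)
  have hu' : ∀ i, Measurable fun s => u s i := fun i => (measurable_pi_apply i).comp hu
  exact (measurableSet_lt (hd j) (hd i)).union
    ((measurableSet_eq_fun (hd j) (hd i)).inter (measurableSet_lt (hu' i) (hu' j)))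

theorem measurable_ncard_setOf {p : S → Fin n → Prop} (h : ∀ j, MeasurableSet {s | p s j}) :
    Measurable fun s => {j | p s j}.ncard := by
  classical
  have : (fun s => {j | p s j}.ncard) = fun s => ∑ j, {s | p s j}.indicator (fun _ => 1) s := by
    funext s
    rw [Set.ncard_eq_toFinset_card', Set.toFinset_ofPred, Finset.card_filter]
    simp [Set.indicator_apply]
  rw [this]
  exact Finset.measurable_sum _ fun j _ => measurable_const.indicator (h j)

theorem measurable_knnWeight (hR : ∀ y, Measurable fun s => R s y) (hu : Measurable u)
    (hxs : Measurable xs) (hx : Measurable x) (i : Fin n) :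
    Measurable fun s => knnWeight k (R s) (u s) (xs s) (x s) i := by
  classical
  unfold knnWeight
  refine Measurable.ite ?_ measurable_const measurable_const
  exact (measurable_ncard_setOf fun j => measurableSet_precedes hR hu hxs hx j i)
    (measurableSet_Iio (a := k))

theorem measurable_label : Measurable fun y : Fin 2 => ((y : ℕ) : ℝ) :=
  measurable_from_top

theorem measurable_knnRegression {D : S → Fin n → (Fin d → ℝ) × Fin 2}
    (hR : ∀ y, Measurable fun s => R s y) (hu : Measurable u) (hD : Measurable D)
    (hx : Measurable x) : Measurable fun s => knnRegression k (R s) (u s) (D s) (x s) := by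
  unfold knnRegression
  refine Finset.measurable_sum _ fun i _ => Measurable.mul ?_ ?_
  · exact measurable_label.comp (measurable_snd.comp ((measurable_pi_apply i).comp hD))
  · exact measurable_knnWeight hR hu (measurable_pi_lambda _ fun j =>
      measurable_fst.comp ((measurable_pi_apply j).comp hD)) hx i

theorem measurable_knnClassifier {D : S → Fin n → (Fin d → ℝ) × Fin 2}
    (hR : ∀ y, Measurable fun s => R s y) (hu : Measurable u) (hD : Measurable D)
    (hx : Measurable x) : Measurable fun s => knnClassifier k (R s) (u s) (D s) (x s) := by
  unfold knnClassifier
  exact Measurable.ite (measurableSet_le measurable_const (measurable_knnRegression hR hu hD hx))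
    measurable_const measurable_const

end Measurability

/-! ### Resampling one coordinate of a product measure -/

section Resampling

theorem measurable_exchange {ι α : Type*} [DecidableEq ι] [MeasurableSpace α] (i : ι)
    {F : (ι → α) → α → ENNReal} (hF : Measurable (Function.uncurry F)) :
    Measurable (Function.uncurry fun D q => F (Function.update D i q) (D i)) :=
  hF.comp (measurable_update'.prodMk ((measurable_pi_apply i).comp measurable_fst))

variable {ι α : Type*} [Fintype ι] [DecidableEq ι] [MeasurableSpace α] (μ : Measure α)
  [IsProbabilityMeasure μ]

theorem measurePreserving_update (i : ι) :
    MeasurePreserving (fun p : (ι → α) × α => Function.update p.1 i p.2)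
      ((Measure.pi fun _ => μ).prod μ) (Measure.pi fun _ => μ) := by
  refine ⟨measurable_update', (Measure.pi_eq fun s hs => ?_).symm⟩
  have hpre : (fun p : (ι → α) × α => Function.update p.1 i p.2) ⁻¹' (Set.univ.pi s)
      = (Set.univ.pi (Function.update s i Set.univ)) ×ˢ s i := by
    ext ⟨D, a⟩
    simp only [Set.mem_preimage, Set.mem_pi, Set.mem_univ, true_imp_iff, Set.mem_prod]
    constructor
    · intro h
      refine ⟨fun j => ?_, by simpa using h i⟩
      by_cases hj : j = i
      · subst hj; simp
      · simpa [hj] using h j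
    · rintro ⟨h, ha⟩ j
      by_cases hj : j = i
      · subst hj; simpa using ha
      · simpa [hj] using h j
  rw [Measure.map_apply measurable_update' (MeasurableSet.univ_pi hs), hpre, Measure.prod_prod,
    Measure.pi_pi, ← Finset.mul_prod_erase _ _ (Finset.mem_univ i),
    ← Finset.mul_prod_erase _ (fun j => μ (s j)) (Finset.mem_univ i), mul_comm]
  simp only [Function.update_self, measure_univ, one_mul]
  congr 1
  exact Finset.prod_congr rfl fun j hj => by rw [Function.update_of_ne (Finset.ne_of_mem_erase hj)]

theorem lintegral_pi_eq_lintegral_update (i : ι) {F : (ι → α) → ENNReal} (hF : Measurable F) :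
    ∫⁻ D, F D ∂(Measure.pi fun _ => μ)
      = ∫⁻ D, ∫⁻ a, F (Function.update D i a) ∂μ ∂(Measure.pi fun _ => μ) := by
  rw [← (measurePreserving_update μ i).lintegral_comp hF, lintegral_prod]
  exact (hF.comp measurable_update').aemeasurable

theorem integral_pi_eq_integral_update (i : ι) {F : (ι → α) → ℝ}
    (hF : Integrable F (Measure.pi fun _ => μ)) :
    ∫ D, F D ∂(Measure.pi fun _ => μ)
      = ∫ D, ∫ a, F (Function.update D i a) ∂μ ∂(Measure.pi fun _ => μ) := by
  have h := measurePreserving_update μ i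
  have hF' : AEStronglyMeasurable F (Measure.map (fun p : (ι → α) × α =>
      Function.update p.1 i p.2) ((Measure.pi fun _ => μ).prod μ)) := by
    rw [h.map_eq]; exact hF.1
  rw [← integral_prod (fun p : (ι → α) × α => F (Function.update p.1 i p.2))
    (h.integrable_comp_of_integrable hF), ← integral_map h.measurable.aemeasurable hF', h.map_eq]

/-- The query can be exchanged with any point of an iid sample. -/
theorem lintegral_exchange (i : ι) {F : (ι → α) → α → ENNReal}
    (hF : Measurable (Function.uncurry F)) :
    ∫⁻ p, F p.1 p.2 ∂((Measure.pi fun _ => μ).prod μ)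
      = ∫⁻ p, F (Function.update p.1 i p.2) (p.1 i) ∂((Measure.pi fun _ => μ).prod μ) := by
  have h1 : Measurable fun D => ∫⁻ q, F D q ∂μ := hF.lintegral_prod_right'
  rw [lintegral_prod (fun p => F p.1 p.2) hF.aemeasurable,
    lintegral_prod (fun p => F (Function.update p.1 i p.2) (p.1 i))
      (measurable_exchange i hF).aemeasurable, lintegral_pi_eq_lintegral_update μ i h1,
    lintegral_pi_eq_lintegral_update μ i
      (F := fun D => ∫⁻ q, F (Function.update D i q) (D i) ∂μ)
      (measurable_exchange i hF).lintegral_prod_right']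
  refine lintegral_congr fun D => ?_
  simp only [Function.update_idem, Function.update_self]
  refine lintegral_lintegral_swap (Measurable.aemeasurable ?_)
  exact hF.comp (((measurable_update D).comp measurable_fst).prodMk measurable_snd)

end Resampling

/-! ### Lower tail of the number of sample points in a set -/

theorem measurable_ncard_mem {ι α : Type*} [Fintype ι] [MeasurableSpace α] {S : Set α}
    (hS : MeasurableSet S) : Measurable fun D : ι → α => {j | D j ∈ S}.ncard := by
  classical
  have : (fun D : ι → α => {j | D j ∈ S}.ncard)
      = fun D => ∑ j, S.indicator (fun _ => 1) (D j) := by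
    funext D
    rw [Set.ncard_eq_toFinset_card', Set.toFinset_ofPred, Finset.card_filter]
    simp [Set.indicator_apply]
  rw [this]
  exact Finset.measurable_sum _ fun j _ =>
    (measurable_const.indicator hS).comp (measurable_pi_apply j)

/-- A Chernoff bound, obtained from the exponential moment of base `1 / 2`. -/
theorem measureReal_ncard_mem_lt_le {α : Type*} [MeasurableSpace α] (μ : Measure α)
    [IsProbabilityMeasure μ] {S : Set α} (hS : MeasurableSet S) (n k : ℕ) :
    (Measure.pi fun _ : Fin n => μ).real {D | {j | D j ∈ S}.ncard < k}
      ≤ Real.exp (k - n * (μ.real S / 2)) := by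
  classical
  set f : α → ℝ := fun a => 1 - S.indicator (fun _ => (1 / 2 : ℝ)) a with hf
  have hf01 : ∀ a, 0 ≤ f a ∧ f a ≤ 1 := fun a => by
    by_cases ha : a ∈ S <;> simp [hf, ha]; norm_num
  have hfm : Measurable f := measurable_const.sub (measurable_const.indicator hS)
  have hfint : ∫ a, f a ∂μ = 1 - μ.real S / 2 := by
    rw [hf, integral_sub (integrable_const _) ((integrable_const _).indicator hS),
      integral_indicator hS]
    simp; ring
  have hprod : ∀ D : Fin n → α, ∏ j, f (D j) = (1 / 2 : ℝ) ^ {j | D j ∈ S}.ncard := fun D => by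
    rw [Set.ncard_eq_toFinset_card', Set.toFinset_ofPred, ← Finset.prod_const,
      Finset.prod_filter]
    refine Finset.prod_congr rfl fun j _ => ?_
    by_cases h : D j ∈ S <;> simp [hf, h]; norm_num
  have hset : MeasurableSet {D : Fin n → α | {j | D j ∈ S}.ncard < k} :=
    measurable_ncard_mem hS measurableSet_Iio
  have hle : ∀ D : Fin n → α, {D : Fin n → α | {j | D j ∈ S}.ncard < k}.indicator
      (fun _ => (1 : ℝ)) D ≤ 2 ^ k * ∏ j, f (D j) := fun D => by
    rw [hprod, Set.indicator_apply]
    split_ifs with h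
    · rw [one_div, inv_pow, ← div_eq_mul_inv, one_le_div (by positivity)]
      exact pow_le_pow_right₀ one_le_two (le_of_lt h)
    · positivity
  have hint : Integrable (fun D : Fin n → α => (2 : ℝ) ^ k * ∏ j, f (D j))
      (Measure.pi fun _ => μ) := by
    refine Integrable.const_mul (Integrable.of_bound (C := 1) ?_ (Eventually.of_forall fun D => ?_)) _
    · exact (Finset.measurable_prod _ fun j _ =>
        hfm.comp (measurable_pi_apply j)).aestronglyMeasurable
    · rw [Real.norm_of_nonneg (Finset.prod_nonneg fun j _ => (hf01 _).1)]
      exact Finset.prod_le_one (fun j _ => (hf01 _).1) fun j _ => (hf01 _).2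
  calc (Measure.pi fun _ : Fin n => μ).real {D | {j | D j ∈ S}.ncard < k}
      = ∫ D, {D : Fin n → α | {j | D j ∈ S}.ncard < k}.indicator (fun _ => (1 : ℝ)) D
          ∂(Measure.pi fun _ => μ) := by rw [integral_indicator hset]; simp
    _ ≤ ∫ D, 2 ^ k * ∏ j, f (D j) ∂(Measure.pi fun _ : Fin n => μ) :=
        integral_mono ((integrable_const _).indicator hset) hint hle
    _ = 2 ^ k * (1 - μ.real S / 2) ^ n := by
        rw [integral_const_mul, integral_fintype_prod_eq_prod (fun _ => f)]
        simp [hfint]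
    _ ≤ Real.exp 1 ^ k * Real.exp (-(μ.real S / 2)) ^ n := by
        have h1 : μ.real S ≤ 1 := measureReal_le_one
        have h2 : 0 ≤ 1 - μ.real S / 2 := by linarith
        refine mul_le_mul (pow_le_pow_left₀ zero_le_two ?_ _)
          (pow_le_pow_left₀ h2 (Real.one_sub_le_exp_neg _) _) (pow_nonneg h2 _) (by positivity)
        linarith [Real.add_one_le_exp (1 : ℝ)]
    _ = Real.exp (k - n * (μ.real S / 2)) := by
        rw [← Real.exp_nat_mul, ← Real.exp_nat_mul, ← Real.exp_add]
        congr 1; ring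

theorem tendsto_measureReal_ncard_mem_lt {α : Type*} [MeasurableSpace α] (μ : Measure α)
    [IsProbabilityMeasure μ] {S : Set α} (hS : MeasurableSet S) (hpos : 0 < μ.real S)
    {k : ℕ → ℕ} (hkn : Tendsto (fun n => (k n : ℝ) / (n : ℝ)) atTop (𝓝 0)) :
    Tendsto (fun n => (Measure.pi fun _ : Fin n => μ).real {D | {j | D j ∈ S}.ncard < k n})
      atTop (𝓝 0) := by
  have h1 : Tendsto (fun n : ℕ => (n : ℝ) * ((k n : ℝ) / n - μ.real S / 2)) atTop atBot := by
    refine Tendsto.atTop_mul_neg (C := 0 - μ.real S / 2) (by linarith)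
      tendsto_natCast_atTop_atTop (hkn.sub_const _)
  refine squeeze_zero' (Eventually.of_forall fun n => measureReal_nonneg) ?_
    (Real.tendsto_exp_atBot.comp h1)
  filter_upwards [eventually_ne_atTop 0] with n hn
  refine (measureReal_ncard_mem_lt_le μ hS n (k n)).trans_eq ?_
  have : (n : ℝ) ≠ 0 := Nat.cast_ne_zero.2 hn
  simp only [Function.comp]
  congr 1; field_simp

/-! ### The regression function -/

section Regression

variable {E : Type*} [MeasurableSpace E]

/-- `η` is a version, with values in `[0, 1]`, of the regression function `E[Y | X = x]` of the
distribution `μ` of (point, label): the residual of the label is orthogonal to all bounded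
functions of the point. -/
structure IsRegressionFunction (μ : Measure (E × Fin 2)) (η : E → ℝ) : Prop where
  measurable : Measurable η
  nonneg : ∀ x, 0 ≤ η x
  le_one : ∀ x, η x ≤ 1
  integral_mul_residual : ∀ (ψ : E → ℝ) (B : ℝ), Measurable ψ → (∀ x, |ψ x| ≤ B) →
    ∫ z, ψ z.1 * (((z.2 : ℕ) : ℝ) - η z.1) ∂μ = 0

theorem label_nonneg (y : Fin 2) : (0 : ℝ) ≤ ((y : ℕ) : ℝ) := Nat.cast_nonneg _

theorem label_le_one (y : Fin 2) : ((y : ℕ) : ℝ) ≤ 1 := by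
  exact_mod_cast Nat.le_of_lt_succ y.2

theorem IsRegressionFunction.abs_residual_le {μ : Measure (E × Fin 2)} {η : E → ℝ}
    (h : IsRegressionFunction μ η) (z : E × Fin 2) : |((z.2 : ℕ) : ℝ) - η z.1| ≤ 1 := by
  have := h.nonneg z.1; have := h.le_one z.1
  have := label_nonneg z.2; have := label_le_one z.2
  rw [abs_le]; constructor <;> linarith

theorem IsRegressionFunction.measurable_residual {μ : Measure (E × Fin 2)} {η : E → ℝ}
    (h : IsRegressionFunction μ η) :
    Measurable fun z : E × Fin 2 => ((z.2 : ℕ) : ℝ) - η z.1 :=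
  (measurable_label.comp measurable_snd).sub (h.measurable.comp measurable_fst)

theorem exists_isRegressionFunction (μ : Measure (E × Fin 2)) [IsProbabilityMeasure μ] :
    ∃ η, IsRegressionFunction μ η := by
  have hint : ∀ x, Integrable (fun y : Fin 2 => ((y : ℕ) : ℝ)) (μ.condKernel x) := fun x =>
    Integrable.of_bound measurable_label.aestronglyMeasurable 1 (Eventually.of_forall fun y => by
      rw [Real.norm_of_nonneg (label_nonneg y)]; exact label_le_one y)
  have hm : Measurable fun x => ∫ y, ((y : ℕ) : ℝ) ∂(μ.condKernel x) :=
    (StronglyMeasurable.integral_kernel (κ := μ.condKernel)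
      measurable_label.stronglyMeasurable).measurable
  have h0 : ∀ x, 0 ≤ ∫ y, ((y : ℕ) : ℝ) ∂(μ.condKernel x) := fun x =>
    integral_nonneg fun y => label_nonneg y
  have h1 : ∀ x, ∫ y, ((y : ℕ) : ℝ) ∂(μ.condKernel x) ≤ 1 := fun x => by
    refine (integral_mono (hint x) (integrable_const 1) fun y => label_le_one y).trans ?_
    simp
  refine ⟨fun x => ∫ y, ((y : ℕ) : ℝ) ∂(μ.condKernel x), hm, h0, h1, fun ψ B hψ hB => ?_⟩
  have hI : Integrable (fun z : E × Fin 2 =>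
      ψ z.1 * (((z.2 : ℕ) : ℝ) - ∫ y, ((y : ℕ) : ℝ) ∂(μ.condKernel z.1))) μ := by
    refine Integrable.of_bound (C := B * 1) ?_ (Eventually.of_forall fun z => ?_)
    · exact ((hψ.comp measurable_fst).mul ((measurable_label.comp measurable_snd).sub
        (hm.comp measurable_fst))).aestronglyMeasurable
    · rw [norm_mul]
      refine mul_le_mul (hB _) ?_ (norm_nonneg _) ((abs_nonneg _).trans (hB z.1))
      have := h0 z.1; have := h1 z.1; have := label_nonneg z.2; have := label_le_one z.2
      rw [Real.norm_eq_abs, abs_le]; constructor <;> linarith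
  rw [← Measure.integral_condKernel hI]
  refine integral_eq_zero_of_ae (Eventually.of_forall fun x => ?_)
  simp only [Pi.zero_apply]
  rw [integral_const_mul, integral_sub (hint x) (integrable_const _)]
  simp

theorem bayesError_le {μ : Measure (E × Fin 2)} {g : E → Fin 2} (hg : Measurable g) :
    bayesError μ ≤ misclassificationError μ g :=
  csInf_le ⟨0, by rintro _ ⟨g, -, rfl⟩; exact measureReal_nonneg⟩ ⟨g, hg, rfl⟩

theorem bayesError_nonneg (μ : Measure (E × Fin 2)) : 0 ≤ bayesError μ :=
  Real.sInf_nonneg (by rintro _ ⟨g, -, rfl⟩; exact measureReal_nonneg)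

variable {μ : Measure (E × Fin 2)} [IsProbabilityMeasure μ] {η : E → ℝ}

theorem IsRegressionFunction.misclassificationError_eq (h : IsRegressionFunction μ η)
    {g : E → Fin 2} (hg : Measurable g) :
    misclassificationError μ g = ∫ z, (if g z.1 = 1 then 1 - η z.1 else η z.1) ∂μ := by
  have hset : MeasurableSet {z : E × Fin 2 | g z.1 ≠ z.2} :=
    (measurableSet_eq_fun (hg.comp measurable_fst) measurable_snd).compl
  have hg1 : MeasurableSet {x | g x = 1} := hg (measurableSet_singleton 1)
  -- the error indicator is `1 - y` where `g = 1` and `y` elsewhere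
  set ψ : E → ℝ := fun x => if g x = 1 then -1 else 1 with hψ
  have hψm : Measurable ψ := Measurable.ite hg1 measurable_const measurable_const
  have hψ1 : ∀ x, |ψ x| ≤ 1 := fun x => by simp only [hψ]; split_ifs <;> simp
  have hcm : Measurable fun x => if g x = 1 then 1 - η x else η x :=
    Measurable.ite hg1 (measurable_const.sub h.measurable) h.measurable
  have hcost : Integrable (fun z : E × Fin 2 => if g z.1 = 1 then 1 - η z.1 else η z.1) μ := by
    refine Integrable.of_bound (C := 1) (hcm.comp measurable_fst).aestronglyMeasurable
      (Eventually.of_forall fun z => ?_)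
    have := h.nonneg z.1; have := h.le_one z.1
    rw [Real.norm_eq_abs, abs_le]
    split_ifs <;> constructor <;> linarith
  have hres : Integrable (fun z : E × Fin 2 => ψ z.1 * (((z.2 : ℕ) : ℝ) - η z.1)) μ := by
    refine Integrable.of_bound (C := 1 * 1)
      ((hψm.comp measurable_fst).mul h.measurable_residual).aestronglyMeasurable
      (Eventually.of_forall fun z => ?_)
    rw [norm_mul]
    exact mul_le_mul (hψ1 _) (h.abs_residual_le z) (norm_nonneg _) zero_le_one
  have hsum : ∀ z : E × Fin 2, {z : E × Fin 2 | g z.1 ≠ z.2}.indicator (fun _ => (1 : ℝ)) z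
      = (if g z.1 = 1 then 1 - η z.1 else η z.1) + ψ z.1 * (((z.2 : ℕ) : ℝ) - η z.1) := by
    rintro ⟨x, y⟩
    have hy : y = 0 ∨ y = 1 := by omega
    have hgx : g x = 0 ∨ g x = 1 := by omega
    rcases hy with rfl | rfl <;> rcases hgx with hgx | hgx <;> simp [hψ, hgx]
  calc misclassificationError μ g
      = ∫ z, {z : E × Fin 2 | g z.1 ≠ z.2}.indicator (fun _ => (1 : ℝ)) z ∂μ := by
        rw [integral_indicator hset]; simp [misclassificationError]
    _ = _ := by
        simp_rw [hsum]
        rw [integral_add hcost hres, h.integral_mul_residual ψ 1 hψm hψ1, add_zero]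

/-- The excess error of a plug-in classifier is at most twice the `L¹` error of the estimate of
the regression function. -/
theorem IsRegressionFunction.misclassificationError_plugin_le (h : IsRegressionFunction μ η)
    {f : E → ℝ} (hf : Measurable f) {B : ℝ} (hB : ∀ x, |f x| ≤ B) :
    misclassificationError μ (fun x => if 1 / 2 ≤ f x then 1 else 0)
      ≤ bayesError μ + 2 * ∫ z, |f z.1 - η z.1| ∂μ := by
  have hfm : Measurable fun x => if 1 / 2 ≤ f x then (1 : Fin 2) else 0 :=
    Measurable.ite (measurableSet_le measurable_const hf) measurable_const measurable_const
  have hdiff : Integrable (fun z : E × Fin 2 => |f z.1 - η z.1|) μ := by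
    refine Integrable.of_bound (C := B + 1) (((hf.sub h.measurable).comp
      measurable_fst).abs).aestronglyMeasurable (Eventually.of_forall fun z => ?_)
    have := h.nonneg z.1; have := h.le_one z.1
    rw [Real.norm_eq_abs, abs_abs]
    refine (abs_sub _ _).trans (add_le_add (hB _) ?_)
    rw [abs_le]; constructor <;> linarith
  have hcost : ∀ g : E → Fin 2, Measurable g →
      Integrable (fun z : E × Fin 2 => if g z.1 = 1 then 1 - η z.1 else η z.1) μ := fun g hg => by
    refine Integrable.of_bound (C := 1) ((Measurable.ite (hg (measurableSet_singleton 1))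
      (measurable_const.sub h.measurable) h.measurable).comp
      measurable_fst).aestronglyMeasurable (Eventually.of_forall fun z => ?_)
    have := h.nonneg z.1; have := h.le_one z.1
    rw [Real.norm_eq_abs, abs_le]
    split_ifs <;> constructor <;> linarith
  rw [← sub_le_iff_le_add]
  refine le_csInf ⟨_, fun _ => 0, measurable_const, rfl⟩ ?_
  rintro _ ⟨g, hg, rfl⟩
  rw [sub_le_iff_le_add, h.misclassificationError_eq hg, h.misclassificationError_eq hfm,
    ← integral_const_mul, ← integral_add (hcost g hg) (hdiff.const_mul 2)]
  refine integral_mono (hcost _ hfm) ((hcost g hg).add (hdiff.const_mul 2)) fun z => ?_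
  have h1 := le_abs_self (f z.1 - η z.1)
  have h2 := neg_abs_le (f z.1 - η z.1)
  have h3 := abs_nonneg (f z.1 - η z.1)
  by_cases hz : 1 / 2 ≤ f z.1
  · simp only [hz, if_true]
    split_ifs <;> linarith
  · simp only [hz, if_false, zero_ne_one]
    split_ifs <;> linarith

end Regression

/-! ### The noise term -/

/-- For weights that depend on the points only, the residuals of the labels at different sample
points are orthogonal, so the second moment of the weighted sum of the residuals is the sum of the
second moments of its terms, and this is at most the largest weight. -/
theorem integral_sq_sum_residual_le {E : Type*} [MeasurableSpace E] {μ : Measure (E × Fin 2)}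
    [IsProbabilityMeasure μ] {η : E → ℝ} (h : IsRegressionFunction μ η) {n : ℕ}
    {w : (Fin n → E) → Fin n → ℝ} (hw : ∀ i, Measurable fun xs => w xs i) {B : ℝ}
    (hw0 : ∀ xs i, 0 ≤ w xs i) (hwB : ∀ xs i, w xs i ≤ B) (hsum : ∀ xs, ∑ i, w xs i = 1) :
    ∫ D, (∑ i, w (fun j => (D j).1) i * ((((D i).2 : ℕ) : ℝ) - η (D i).1)) ^ 2
      ∂(Measure.pi fun _ : Fin n => μ) ≤ B := by
  classical
  set e : E × Fin 2 → ℝ := fun z => ((z.2 : ℕ) : ℝ) - η z.1 with he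
  have hem : Measurable e := h.measurable_residual
  have he1 : ∀ z, |e z| ≤ 1 := h.abs_residual_le
  set W : Fin n → (Fin n → E × Fin 2) → ℝ := fun i D => w (fun j => (D j).1) i with hW
  have hfst : Measurable fun (D : Fin n → E × Fin 2) (j : Fin n) => (D j).1 :=
    measurable_pi_lambda _ fun j => measurable_fst.comp (measurable_pi_apply j)
  have hWm : ∀ i, Measurable (W i) := fun i => (hw i).comp hfst
  have hWB : ∀ i D, |W i D| ≤ B := fun i D => by
    rw [abs_of_nonneg (hw0 _ _)]; exact hwB _ _
  have hterm : ∀ i j, Integrable (fun D : Fin n → E × Fin 2 =>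
      (W i D * e (D i)) * (W j D * e (D j))) (Measure.pi fun _ => μ) := fun i j => by
    refine Integrable.of_bound (C := (B * 1) * (B * 1)) ?_ (Eventually.of_forall fun D => ?_)
    · exact (((hWm i).mul (hem.comp (measurable_pi_apply i))).mul
        ((hWm j).mul (hem.comp (measurable_pi_apply j)))).aestronglyMeasurable
    · have hB0 : 0 ≤ B := (abs_nonneg _).trans (hWB i D)
      have hle : ∀ i, |W i D * e (D i)| ≤ B * 1 := fun i => by
        rw [abs_mul]; exact mul_le_mul (hWB i D) (he1 _) (abs_nonneg _) hB0
      rw [norm_mul]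
      exact mul_le_mul (hle i) (hle j) (abs_nonneg _) (by positivity)
  have hcross : ∀ i j, j ≠ i → ∫ D, (W i D * e (D i)) * (W j D * e (D j))
      ∂(Measure.pi fun _ : Fin n => μ) = 0 := fun i j hij => by
    rw [integral_pi_eq_integral_update μ i (hterm i j)]
    refine integral_eq_zero_of_ae (Eventually.of_forall fun D => ?_)
    -- integrating over the label of the `i`-th pair first
    let xs' : E → Fin n → E := fun x => Function.update (fun l => (D l).1) i x
    have hxs' : Measurable xs' := measurable_update _
    have hupd : ∀ z : E × Fin 2, (fun l => (Function.update D i z l).1) = xs' z.1 := fun z => by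
      funext l
      by_cases hl : l = i
      · subst hl; simp [xs']
      · simp [xs', hl]
    have := h.integral_mul_residual (fun x => w (xs' x) i * (w (xs' x) j * e (D j)))
      (B * (B * 1)) (((hw i).comp hxs').mul (((hw j).comp hxs').mul measurable_const))
      (fun x => by
        have hB0 : 0 ≤ B := (hw0 (xs' x) i).trans (hwB _ _)
        rw [abs_mul, abs_mul, abs_of_nonneg (hw0 _ _), abs_of_nonneg (hw0 _ _)]
        exact mul_le_mul (hwB _ _) (mul_le_mul (hwB _ _) (he1 _) (abs_nonneg _) hB0)
          (mul_nonneg (hw0 _ _) (abs_nonneg _)) hB0)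
    rw [Pi.zero_apply, ← this]
    refine integral_congr_ae (Eventually.of_forall fun z => ?_)
    simp only [hW, hupd, Function.update_self, Function.update_of_ne hij]
    ring
  have hWint : ∀ i, Integrable (fun D => B * W i D) (Measure.pi fun _ : Fin n => μ) := fun i =>
    (Integrable.of_bound (C := B) (hWm i).aestronglyMeasurable
      (Eventually.of_forall fun D => hWB i D)).const_mul B
  calc ∫ D, (∑ i, W i D * e (D i)) ^ 2 ∂(Measure.pi fun _ : Fin n => μ)
      = ∑ i, ∑ j, ∫ D, (W i D * e (D i)) * (W j D * e (D j))
          ∂(Measure.pi fun _ : Fin n => μ) := by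
        simp_rw [sq, Finset.sum_mul_sum]
        rw [integral_finsetSum _ fun i _ => integrable_finsetSum _ fun j _ => hterm i j]
        exact Finset.sum_congr rfl fun i _ => integral_finsetSum _ fun j _ => hterm i j
    _ = ∑ i, ∫ D, (W i D * e (D i)) * (W i D * e (D i)) ∂(Measure.pi fun _ : Fin n => μ) :=
        Finset.sum_congr rfl fun i _ => Finset.sum_eq_single i (fun j _ hj => hcross i j hj)
          (by simp)
    _ ≤ ∑ i, ∫ D, B * W i D ∂(Measure.pi fun _ : Fin n => μ) := by
        refine Finset.sum_le_sum fun i _ => integral_mono (hterm i i) (hWint i) fun D => ?_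
        have h1 : e (D i) * e (D i) ≤ 1 := by
          have := abs_le.1 (he1 (D i)); nlinarith
        have h2 : 0 ≤ W i D := hw0 _ _
        have h3 : W i D ≤ B := hwB _ _
        calc W i D * e (D i) * (W i D * e (D i)) = (W i D * W i D) * (e (D i) * e (D i)) := by ring
          _ ≤ (W i D * W i D) * 1 := by gcongr
          _ ≤ B * W i D := by rw [mul_one]; gcongr
    _ = B := by
        rw [← integral_finsetSum _ fun i _ => hWint i]
        simp_rw [← Finset.mul_sum]
        simp [hW, hsum]

/-! ### Uniform consistency of the regression estimate -/

/-- The joint law of an iid sample of size `n` from `μ` and an independent query from `μ`. -/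
abbrev sampleQueryMeasure {A : Type*} [MeasurableSpace A] (μ : Measure A) (n : ℕ) :
    Measure ((Fin n → A) × A) :=
  (Measure.pi fun _ => μ).prod μ

theorem lintegral_sampleQueryMeasure_query {A : Type*} [MeasurableSpace A] (μ : Measure A)
    [IsProbabilityMeasure μ] (n : ℕ) {F : A → ENNReal} (hF : Measurable F) :
    ∫⁻ p, F p.2 ∂(sampleQueryMeasure μ n) = ∫⁻ z, F z ∂μ :=
  measurePreserving_snd.lintegral_comp hF

section Consistency

variable {d : ℕ} {μ : Measure ((Fin d → ℝ) × Fin 2)} [IsProbabilityMeasure μ]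

theorem measurable_points (n : ℕ) :
    Measurable fun (D : Fin n → (Fin d → ℝ) × Fin 2) (j : Fin n) => (D j).1 :=
  measurable_pi_lambda _ fun j => measurable_fst.comp (measurable_pi_apply j)

theorem measurable_knnWeight_sampleQuery (k : ℕ) (ρ : Seminorm ℝ (Fin d → ℝ)) {n : ℕ}
    (u : Fin n → ℝ) (i : Fin n) :
    Measurable fun p : (Fin n → (Fin d → ℝ) × Fin 2) × ((Fin d → ℝ) × Fin 2) =>
      knnWeight k ρ u (fun j => (p.1 j).1) p.2.1 i :=
  measurable_knnWeight (fun _ => measurable_const) measurable_const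
    ((measurable_points n).comp measurable_fst) (measurable_fst.comp measurable_snd) i

/-- The expected weighted sum of the values of `f` at the sample points is at most a constant
multiple of the integral of `f`: after exchanging the query with each sample point in turn, this
is the counting bound on nearest neighbours. -/
theorem lintegral_sum_knnWeight_mul_le {k n m : ℕ} {ρ : Seminorm ℝ (Fin d → ℝ)} {u : Fin n → ℝ}
    (hm : ∀ (xs : Fin n → Fin d → ℝ) (x : Fin d → ℝ),
      {i | IsNearestNeighbour k ρ u (Function.update xs i x) (xs i) i}.ncard ≤ m * k)
    {f : (Fin d → ℝ) → ENNReal} (hf : Measurable f) :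
    ∫⁻ p, ∑ i, ENNReal.ofReal (knnWeight k ρ u (fun j => (p.1 j).1) p.2.1 i) * f (p.1 i).1
      ∂(sampleQueryMeasure μ n) ≤ m * ∫⁻ z, f z.1 ∂μ := by
  set F : Fin n → (Fin n → (Fin d → ℝ) × Fin 2) → (Fin d → ℝ) × Fin 2 → ENNReal :=
    fun i D q => ENNReal.ofReal (knnWeight k ρ u (fun j => (D j).1) q.1 i) * f (D i).1 with hF
  have hFm : ∀ i, Measurable (Function.uncurry (F i)) := fun i => by
    have h1 : Measurable fun p : (Fin n → (Fin d → ℝ) × Fin 2) × ((Fin d → ℝ) × Fin 2) =>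
        f (p.1 i).1 :=
      hf.comp (measurable_fst.comp ((measurable_pi_apply i).comp measurable_fst))
    exact (measurable_knnWeight_sampleQuery k ρ u i).ennreal_ofReal.mul h1
  have hFm' : ∀ i, Measurable (Function.uncurry fun D q => F i (Function.update D i q) (D i)) :=
    fun i => measurable_exchange i (hFm i)
  have hval : ∀ i D q, F i (Function.update D i q) (D i) = ENNReal.ofReal
      (knnWeight k ρ u (Function.update (fun j => (D j).1) i q.1) (D i).1 i) * f q.1 :=
    fun i D q => by
      have : (fun j => (Function.update D i q j).1)
          = Function.update (fun j => (D j).1) i q.1 := by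
        funext j
        by_cases hj : j = i
        · subst hj; simp
        · simp [hj]
      simp only [hF, this, Function.update_self]
  calc ∫⁻ p, ∑ i, F i p.1 p.2 ∂(sampleQueryMeasure μ n)
      = ∑ i, ∫⁻ p, F i p.1 p.2 ∂(sampleQueryMeasure μ n) :=
        lintegral_finsetSum _ fun i _ => hFm i
    _ = ∑ i, ∫⁻ p, F i (Function.update p.1 i p.2) (p.1 i) ∂(sampleQueryMeasure μ n) :=
        Finset.sum_congr rfl fun i _ => lintegral_exchange μ i (hFm i)
    _ = ∫⁻ p, ∑ i, F i (Function.update p.1 i p.2) (p.1 i) ∂(sampleQueryMeasure μ n) :=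
        (lintegral_finsetSum _ fun i _ => hFm' i).symm
    _ ≤ ∫⁻ p, m * f p.2.1 ∂(sampleQueryMeasure μ n) := by
        refine lintegral_mono fun p => ?_
        simp_rw [hval]
        rw [← Finset.sum_mul, ← ENNReal.ofReal_sum_of_nonneg fun i _ => knnWeight_nonneg i]
        gcongr
        rw [← ENNReal.ofReal_natCast]
        exact ENNReal.ofReal_le_ofReal (sum_knnWeight_update_le (hm _ _))
    _ = m * ∫⁻ z, f z.1 ∂μ := by
        rw [lintegral_sampleQueryMeasure_query μ n (F := fun z => (m : ENNReal) * f z.1)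
            (measurable_const.mul (hf.comp measurable_fst)),
          lintegral_const_mul (f := fun z : (Fin d → ℝ) × Fin 2 => f z.1) _
            (hf.comp measurable_fst)]

/-- The expected noise. The second moment is at most `1 / k`, and it controls the first one by
`|t| ≤ δ / 2 + t² / (2δ)`. -/
theorem lintegral_abs_sum_residual_le {η : (Fin d → ℝ) → ℝ} (h : IsRegressionFunction μ η)
    {k n : ℕ} (hk₀ : 0 < k) (hkn : k ≤ n) (ρ : Seminorm ℝ (Fin d → ℝ)) {u : Fin n → ℝ}
    (hu : Function.Injective u) {δ : ℝ} (hδ : 0 < δ) :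
    ∫⁻ p, ENNReal.ofReal |∑ i, knnWeight k ρ u (fun j => (p.1 j).1) p.2.1 i
        * ((((p.1 i).2 : ℕ) : ℝ) - η (p.1 i).1)| ∂(sampleQueryMeasure μ n)
      ≤ ENNReal.ofReal (δ / 2 + 1 / (2 * δ * k)) := by
  set H : (Fin n → (Fin d → ℝ) × Fin 2) → (Fin d → ℝ) × Fin 2 → ℝ := fun D q =>
    ∑ i, knnWeight k ρ u (fun j => (D j).1) q.1 i * ((((D i).2 : ℕ) : ℝ) - η (D i).1) with hH
  have hHm : Measurable (Function.uncurry H) := by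
    refine Finset.measurable_sum _ fun i _ => ?_
    have h1 : Measurable fun p : (Fin n → (Fin d → ℝ) × Fin 2) × ((Fin d → ℝ) × Fin 2) =>
        (((p.1 i).2 : ℕ) : ℝ) - η (p.1 i).1 :=
      h.measurable_residual.comp ((measurable_pi_apply i).comp measurable_fst)
    exact (measurable_knnWeight_sampleQuery k ρ u i).mul h1
  have hH1 : ∀ D q, |H D q| ≤ 1 := fun D q => by
    calc |H D q| ≤ ∑ i, |knnWeight k ρ u (fun j => (D j).1) q.1 i
          * ((((D i).2 : ℕ) : ℝ) - η (D i).1)| := Finset.abs_sum_le_sum_abs _ _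
      _ ≤ ∑ i, knnWeight k ρ u (fun j => (D j).1) q.1 i := by
          refine Finset.sum_le_sum fun i _ => ?_
          rw [abs_mul, abs_of_nonneg (knnWeight_nonneg i)]
          exact mul_le_of_le_one_right (knnWeight_nonneg i) (h.abs_residual_le _)
      _ = 1 := sum_knnWeight hu hk₀ hkn
  have hsec : ∀ q, Measurable fun D => H D q := fun q =>
    hHm.of_uncurry_right
  have hI : ∀ q, Integrable (fun D => |H D q|) (Measure.pi fun _ : Fin n => μ) := fun q =>
    Integrable.of_bound (C := 1) (hsec q).abs.aestronglyMeasurable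
      (Eventually.of_forall fun D => by rw [Real.norm_eq_abs, abs_abs]; exact hH1 D q)
  have hI2 : ∀ q, Integrable (fun D => H D q ^ 2) (Measure.pi fun _ : Fin n => μ) := fun q =>
    Integrable.of_bound (C := 1) ((hsec q).pow_const 2).aestronglyMeasurable
      (Eventually.of_forall fun D => by
        rw [Real.norm_eq_abs, abs_of_nonneg (sq_nonneg _), sq_le_one_iff_abs_le_one]
        exact hH1 D q)
  change ∫⁻ p, ENNReal.ofReal |H p.1 p.2| ∂(sampleQueryMeasure μ n) ≤ _
  rw [lintegral_prod_symm (fun p => ENNReal.ofReal |H p.1 p.2|)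
    hHm.abs.ennreal_ofReal.aemeasurable]
  have hq : ∀ q, ∫⁻ D, ENNReal.ofReal |H D q| ∂(Measure.pi fun _ : Fin n => μ)
      ≤ ENNReal.ofReal (δ / 2 + 1 / (2 * δ * k)) := fun q => by
    rw [← ofReal_integral_eq_lintegral_ofReal (hI q) (Eventually.of_forall fun D => abs_nonneg _)]
    refine ENNReal.ofReal_le_ofReal ?_
    have hsecond : ∫ D, H D q ^ 2 ∂(Measure.pi fun _ : Fin n => μ) ≤ 1 / k :=
      integral_sq_sum_residual_le h
        (w := fun xs i => knnWeight k ρ u xs q.1 i)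
        (fun i => measurable_knnWeight (fun _ => measurable_const) measurable_const
          measurable_id measurable_const i)
        (fun xs i => knnWeight_nonneg i) (fun xs i => knnWeight_le i)
        (fun xs => sum_knnWeight hu hk₀ hkn)
    calc ∫ D, |H D q| ∂(Measure.pi fun _ : Fin n => μ)
        ≤ ∫ D, (δ / 2 + 1 / (2 * δ) * H D q ^ 2) ∂(Measure.pi fun _ : Fin n => μ) := by
          refine integral_mono (hI q) ((integrable_const _).add ((hI2 q).const_mul _)) fun D => ?_
          have h0 : 0 ≤ 1 / (2 * δ) * (|H D q| - δ) ^ 2 := by positivity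
          have h1 : 1 / (2 * δ) * (|H D q| - δ) ^ 2
              = δ / 2 + 1 / (2 * δ) * H D q ^ 2 - |H D q| := by
            rw [sub_sq, sq_abs]; field_simp; ring
          change |H D q| ≤ δ / 2 + 1 / (2 * δ) * H D q ^ 2
          linarith
      _ = δ / 2 + 1 / (2 * δ) * ∫ D, H D q ^ 2 ∂(Measure.pi fun _ : Fin n => μ) := by
          rw [integral_add (integrable_const _) ((hI2 q).const_mul _), integral_const_mul]
          simp
      _ ≤ δ / 2 + 1 / (2 * δ) * (1 / k) := by gcongr
      _ = δ / 2 + 1 / (2 * δ * k) := by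
          rw [div_mul_div_comm, one_mul]
  calc ∫⁻ q, ∫⁻ D, ENNReal.ofReal |H D q| ∂(Measure.pi fun _ : Fin n => μ) ∂μ
      ≤ ∫⁻ _, ENNReal.ofReal (δ / 2 + 1 / (2 * δ * k)) ∂μ := lintegral_mono hq
    _ = _ := by simp

/-- The event that fewer than `k` sample points lie within distance `b` of the query. -/
def sparseSet (d k n : ℕ) (b : ℝ) :
    Set ((Fin n → (Fin d → ℝ) × Fin 2) × ((Fin d → ℝ) × Fin 2)) :=
  {p | {j | ‖(p.1 j).1 - p.2.1‖ ≤ b}.ncard < k}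

theorem measurableSet_sparseSet (k n : ℕ) (b : ℝ) : MeasurableSet (sparseSet d k n b) := by
  have : Measurable fun p : (Fin n → (Fin d → ℝ) × Fin 2) × ((Fin d → ℝ) × Fin 2) =>
      {j | ‖(p.1 j).1 - p.2.1‖ ≤ b}.ncard := measurable_ncard_setOf fun j =>
    measurableSet_le ((measurable_fst.comp ((measurable_pi_apply j).comp measurable_fst)).sub
      (measurable_fst.comp measurable_snd)).norm measurable_const
  exact this measurableSet_Iio

theorem tendsto_measure_sparseSet {b : ℝ} (hb : 0 < b) {k : ℕ → ℕ}
    (hkn : Tendsto (fun n => (k n : ℝ) / (n : ℝ)) atTop (𝓝 0)) :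
    Tendsto (fun n => sampleQueryMeasure μ n (sparseSet d (k n) n b)) atTop (𝓝 0) := by
  have hball : ∀ᵐ q ∂μ, 0 < μ.real {z | ‖z.1 - q.1‖ ≤ b} := by
    have h := (Measure.support_mem_ae (μ := μ.map Prod.fst))
    filter_upwards [ae_of_ae_map measurable_fst.aemeasurable h] with q hq
    have h1 := (Measure.mem_support_iff_forall _).1 hq _ (Metric.closedBall_mem_nhds q.1 hb)
    rw [Measure.map_apply measurable_fst measurableSet_closedBall] at h1
    refine ENNReal.toReal_pos (ne_of_gt ?_) (measure_ne_top _ _)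
    convert h1 using 2
    ext z
    simp [dist_eq_norm]
  simp_rw [Measure.prod_apply_symm (measurableSet_sparseSet _ _ _)]
  have hlim := tendsto_lintegral_of_dominated_convergence (μ := μ)
    (F := fun n q => (Measure.pi fun _ : Fin n => μ)
      ((fun D => (D, q)) ⁻¹' sparseSet d (k n) n b)) (f := fun _ => 0) (fun _ => 1)
    (fun n => measurable_measure_prodMk_right (measurableSet_sparseSet _ _ _))
    (fun n => Eventually.of_forall fun q => prob_le_one) (by simp) ?_
  · simpa using hlim
  filter_upwards [hball] with q hq
  have hS : MeasurableSet {z : (Fin d → ℝ) × Fin 2 | ‖z.1 - q.1‖ ≤ b} :=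
    measurableSet_le (measurable_fst.sub measurable_const).norm measurable_const
  have h1 := tendsto_measureReal_ncard_mem_lt μ hS hq hkn
  rw [← ENNReal.tendsto_toReal_iff (fun n => measure_ne_top _ _) ENNReal.zero_ne_top]
  exact h1

/-- The expected oscillation, over the nearest neighbours, of a bounded function that varies by at
most `ε` at distances up to `C / c * b`: unless fewer than `k` sample points lie within distance
`b`, all the nearest neighbours lie within distance `C / c * b`. -/
theorem lintegral_sum_knnWeight_mul_abs_sub_le {c C : ℝ} (hc : 0 < c) (hC : 0 < C)
    {g : (Fin d → ℝ) → ℝ} {B b ε : ℝ} (hB : ∀ x, |g x| ≤ B)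
    (hosc : ∀ x y, ‖y - x‖ ≤ C / c * b → |g y - g x| ≤ ε) {k n : ℕ} (hk₀ : 0 < k) (hkn : k ≤ n)
    {ρ : Seminorm ℝ (Fin d → ℝ)} (hρ : ∀ x, c * ‖x‖ ≤ ρ x ∧ ρ x ≤ C * ‖x‖) {u : Fin n → ℝ}
    (hu : Function.Injective u) :
    ∫⁻ p, ∑ i, ENNReal.ofReal (knnWeight k ρ u (fun j => (p.1 j).1) p.2.1 i)
        * ENNReal.ofReal |g (p.1 i).1 - g p.2.1| ∂(sampleQueryMeasure μ n)
      ≤ ENNReal.ofReal ε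
        + ENNReal.ofReal (2 * B) * sampleQueryMeasure μ n (sparseSet d k n b) := by
  have hB0 : 0 ≤ B := (abs_nonneg _).trans (hB 0)
  have hone : ∀ (xs : Fin n → Fin d → ℝ) (x : Fin d → ℝ),
      ∑ i, ENNReal.ofReal (knnWeight k ρ u xs x i) = 1 := fun xs x => by
    rw [← ENNReal.ofReal_sum_of_nonneg fun i _ => knnWeight_nonneg i,
      sum_knnWeight hu hk₀ hkn, ENNReal.ofReal_one]
  calc _ ≤ ∫⁻ p, (ENNReal.ofReal ε + (sparseSet d k n b).indicator
          (fun _ => ENNReal.ofReal (2 * B)) p) ∂(sampleQueryMeasure μ n) := by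
        refine lintegral_mono fun p => ?_
        by_cases hp : p ∈ sparseSet d k n b
        · rw [Set.indicator_of_mem hp]
          refine le_add_left ?_
          calc _ ≤ ∑ i, ENNReal.ofReal (knnWeight k ρ u (fun j => (p.1 j).1) p.2.1 i)
                * ENNReal.ofReal (2 * B) := by
                gcongr with i
                refine (abs_sub _ _).trans ?_
                linarith [hB (p.1 i).1, hB p.2.1]
            _ = _ := by rw [← Finset.sum_mul, hone, one_mul]
        · rw [Set.indicator_of_notMem hp, add_zero]
          have hk : k ≤ {j | ρ ((p.1 j).1 - p.2.1) ≤ C * b}.ncard := by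
            refine (not_lt.1 hp).trans (Set.ncard_le_ncard fun j hj => ?_)
            exact ((hρ _).2).trans (mul_le_mul_of_nonneg_left hj hC.le)
          calc _ ≤ ∑ i, ENNReal.ofReal (knnWeight k ρ u (fun j => (p.1 j).1) p.2.1 i)
                * ENNReal.ofReal ε := by
                refine Finset.sum_le_sum fun i _ => ?_
                by_cases hi : knnWeight k ρ u (fun j => (p.1 j).1) p.2.1 i = 0
                · simp [hi]
                gcongr
                refine hosc _ _ ?_
                have h1 := ((hρ _).1).trans (dist_le_of_knnWeight_ne_zero hk hi)
                rwa [div_mul_eq_mul_div, le_div_iff₀' hc]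
            _ = _ := by rw [← Finset.sum_mul, hone, one_mul]
    _ = _ := by
        rw [lintegral_add_left measurable_const,
          lintegral_indicator_const (measurableSet_sparseSet _ _ _)]
        simp

/-- The `k` nearest neighbour estimates of the regression function converge to it in mean,
uniformly over the seminorms with given constants of equivalence and over all systems of distinct
tie-breakers. -/
theorem eventually_lintegral_abs_knnRegression_sub_le {η : (Fin d → ℝ) → ℝ}
    (h : IsRegressionFunction μ η) {c C : ℝ} (hc : 0 < c) (hC : 0 < C) {k : ℕ → ℕ}
    (hk : Tendsto k atTop atTop)
    (hkn : Tendsto (fun n => (k n : ℝ) / (n : ℝ)) atTop (𝓝 0)) {ε : ℝ} (hε : 0 < ε) :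
    ∀ᶠ n in atTop, (0 < k n ∧ k n ≤ n) ∧ ∀ ρ : Seminorm ℝ (Fin d → ℝ),
      (∀ x, c * ‖x‖ ≤ ρ x ∧ ρ x ≤ C * ‖x‖) →
      ∀ u : Fin n → ℝ, Function.Injective u →
        ∫⁻ p, ENNReal.ofReal |knnRegression (k n) ρ u p.1 p.2.1 - η p.2.1|
          ∂(sampleQueryMeasure μ n) ≤ ENNReal.ofReal ε := by
  obtain ⟨m, hm⟩ := exists_card_isNearestNeighbour_update_le d hc hC
  have hηint : Integrable η (μ.map Prod.fst) :=
    Integrable.of_bound (C := 1) h.measurable.aestronglyMeasurable (Eventually.of_forall fun x => by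
      rw [Real.norm_of_nonneg (h.nonneg x)]; exact h.le_one x)
  -- `g` is used `m + 1` times, at the neighbours with total mass `m` and once at the query
  obtain ⟨g, hgsupp, hgη, hgc, -⟩ := hηint.exists_hasCompactSupport_lintegral_sub_le
    (ε := ENNReal.ofReal (ε / (4 * (m + 1)))) (by simp; positivity)
  have hηg : Measurable fun x => ENNReal.ofReal |η x - g x| :=
    (h.measurable.sub hgc.measurable).abs.ennreal_ofReal
  have hgη' : ∫⁻ z, ENNReal.ofReal |η z.1 - g z.1| ∂μ ≤ ENNReal.ofReal (ε / (4 * (m + 1))) := by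
    rw [← lintegral_map hηg measurable_fst]
    simpa only [← Real.enorm_eq_ofReal_abs] using hgη
  obtain ⟨B, hB⟩ := hgsupp.exists_bound_of_continuous hgc
  have hB' : ∀ x, |g x| ≤ B := hB
  have hB0 : 0 ≤ B := (abs_nonneg _).trans (hB' 0)
  obtain ⟨r, hr, hosc⟩ := Metric.uniformContinuous_iff.1
    (hgsupp.uniformContinuous_of_continuous hgc) (ε / 4) (by positivity)
  -- the ratio `c / C` is what is lost in passing from the norm to `ρ` and back
  set b : ℝ := c / C * (r / 2) with hb
  have hb0 : 0 < b := by positivity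
  have hosc' : ∀ x y, ‖y - x‖ ≤ C / c * b → |g y - g x| ≤ ε / 4 := fun x y hxy => by
    refine (hosc (a := y) (b := x) ?_).le
    have : C / c * b = r / 2 := by rw [hb]; field_simp
    rw [dist_eq_norm]; linarith
  have hk₀ : ∀ᶠ n in atTop, 0 < k n := hk.eventually_gt_atTop 0
  have hkle : ∀ᶠ n in atTop, k n ≤ n := by
    filter_upwards [hkn.eventually_lt_const one_pos, eventually_gt_atTop 0] with n h1 h0
    rw [div_lt_one (by exact_mod_cast h0)] at h1
    exact_mod_cast h1.le
  have hsparse : ∀ᶠ n in atTop, ENNReal.ofReal (2 * B)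
      * sampleQueryMeasure μ n (sparseSet d (k n) n b) ≤ ENNReal.ofReal (ε / 4) := by
    have h1 := ENNReal.Tendsto.const_mul (a := ENNReal.ofReal (2 * B))
      (tendsto_measure_sparseSet (μ := μ) hb0 hkn) (Or.inr ENNReal.ofReal_ne_top)
    rw [mul_zero] at h1
    exact h1.eventually_le_const (by simpa using hε)
  have hnoise : ∀ᶠ n in atTop, (ε / 4) / 2 + 1 / (2 * (ε / 4) * (k n : ℝ)) ≤ ε / 4 := by
    have hk' : Tendsto (fun n => (k n : ℝ)) atTop atTop := tendsto_natCast_atTop_atTop.comp hk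
    have h1 : Tendsto (fun n => (ε / 4) / 2 + 1 / (2 * (ε / 4) * (k n : ℝ))) atTop
        (𝓝 ((ε / 4) / 2 + 0)) :=
      ((hk'.const_mul_atTop (by positivity)).const_div_atTop 1).const_add _
    exact h1.eventually_le_const (by linarith)
  filter_upwards [hk₀, hkle, hsparse, hnoise] with n hk₀ hkle hsparse hnoise
  refine ⟨⟨hk₀, hkle⟩, fun ρ hρ u hu => ?_⟩
  set w : (Fin n → (Fin d → ℝ) × Fin 2) × ((Fin d → ℝ) × Fin 2) → Fin n → ℝ :=
    fun p i => knnWeight (k n) ρ u (fun j => (p.1 j).1) p.2.1 i with hw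
  have hw0 : ∀ p i, 0 ≤ w p i := fun p i => knnWeight_nonneg i
  have hw1 : ∀ p, ∑ i, w p i = 1 := fun p => sum_knnWeight hu hk₀ hkle
  have hwm : ∀ i, Measurable fun p => w p i := measurable_knnWeight_sampleQuery (k n) ρ u
  -- noise, then the bias with `η` replaced by `g` at the neighbours and at the query
  have hpt : ∀ p, |knnRegression (k n) ρ u p.1 p.2.1 - η p.2.1|
      ≤ |∑ i, w p i * ((((p.1 i).2 : ℕ) : ℝ) - η (p.1 i).1)|
        + (∑ i, w p i * |η (p.1 i).1 - g (p.1 i).1|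
        + (∑ i, w p i * |g (p.1 i).1 - g p.2.1| + |η p.2.1 - g p.2.1|)) := fun p => by
    have hdec : knnRegression (k n) ρ u p.1 p.2.1 - η p.2.1
        = ∑ i, w p i * ((((p.1 i).2 : ℕ) : ℝ) - η (p.1 i).1)
          + ∑ i, w p i * (η (p.1 i).1 - η p.2.1) := by
      simp_rw [mul_sub, Finset.sum_sub_distrib, ← Finset.sum_mul, hw1, one_mul, knnRegression,
        mul_comm _ (knnWeight _ _ _ _ _ _)]
      ring
    have hlast : |η p.2.1 - g p.2.1| = ∑ i, w p i * |η p.2.1 - g p.2.1| := by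
      rw [← Finset.sum_mul, hw1, one_mul]
    rw [hdec]
    refine (abs_add_le _ _).trans (add_le_add le_rfl ?_)
    refine (Finset.abs_sum_le_sum_abs _ _).trans ?_
    rw [hlast, ← Finset.sum_add_distrib, ← Finset.sum_add_distrib]
    refine Finset.sum_le_sum fun i _ => ?_
    rw [abs_mul, abs_of_nonneg (hw0 p i), ← mul_add, ← mul_add]
    refine mul_le_mul_of_nonneg_left ?_ (hw0 p i)
    have h1 := abs_sub_le (η (p.1 i).1) (g (p.1 i).1) (η p.2.1)
    have h2 := abs_sub_le (g (p.1 i).1) (g p.2.1) (η p.2.1)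
    rw [abs_sub_comm (g p.2.1)] at h2
    linarith
  have hpt' : ∀ p, ENNReal.ofReal |knnRegression (k n) ρ u p.1 p.2.1 - η p.2.1|
      ≤ ENNReal.ofReal |∑ i, w p i * ((((p.1 i).2 : ℕ) : ℝ) - η (p.1 i).1)|
        + (∑ i, ENNReal.ofReal (w p i) * ENNReal.ofReal |η (p.1 i).1 - g (p.1 i).1|
        + (∑ i, ENNReal.ofReal (w p i) * ENNReal.ofReal |g (p.1 i).1 - g p.2.1|
        + ENNReal.ofReal |η p.2.1 - g p.2.1|)) := fun p => by
    have hs : ∀ a : Fin n → ℝ, (∀ i, 0 ≤ a i) →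
        ENNReal.ofReal (∑ i, w p i * a i) = ∑ i, ENNReal.ofReal (w p i) * ENNReal.ofReal (a i) :=
      fun a ha => by
        rw [ENNReal.ofReal_sum_of_nonneg fun i _ => mul_nonneg (hw0 p i) (ha i)]
        exact Finset.sum_congr rfl fun i _ => ENNReal.ofReal_mul (hw0 p i)
    refine (ENNReal.ofReal_le_ofReal (hpt p)).trans ?_
    rw [← hs _ fun i => abs_nonneg _, ← hs _ fun i => abs_nonneg _]
    refine ENNReal.ofReal_add_le.trans (add_le_add le_rfl ?_)
    exact ENNReal.ofReal_add_le.trans (add_le_add le_rfl ENNReal.ofReal_add_le)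
  have hx : ∀ i, Measurable fun p : (Fin n → (Fin d → ℝ) × Fin 2) × ((Fin d → ℝ) × Fin 2) =>
      (p.1 i).1 := fun i => measurable_fst.comp ((measurable_pi_apply i).comp measurable_fst)
  have hm1 : Measurable fun p : (Fin n → (Fin d → ℝ) × Fin 2) × ((Fin d → ℝ) × Fin 2) =>
      ENNReal.ofReal |∑ i, w p i * ((((p.1 i).2 : ℕ) : ℝ) - η (p.1 i).1)| :=
    (Finset.measurable_sum _ fun i _ => (hwm i).mul (h.measurable_residual.comp
      ((measurable_pi_apply i).comp measurable_fst))).abs.ennreal_ofReal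
  have hm2 : Measurable fun p => ∑ i, ENNReal.ofReal (w p i)
      * ENNReal.ofReal |η (p.1 i).1 - g (p.1 i).1| :=
    Finset.measurable_sum _ fun i _ => (hwm i).ennreal_ofReal.mul (hηg.comp (hx i))
  have hm3 : Measurable fun p => ∑ i, ENNReal.ofReal (w p i)
      * ENNReal.ofReal |g (p.1 i).1 - g p.2.1| :=
    Finset.measurable_sum _ fun i _ => (hwm i).ennreal_ofReal.mul
      ((hgc.measurable.comp (hx i)).sub (hgc.measurable.comp
        (measurable_fst.comp measurable_snd))).abs.ennreal_ofReal
  have hlast : ∫⁻ p, ENNReal.ofReal |η p.2.1 - g p.2.1| ∂(sampleQueryMeasure μ n)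
      = ∫⁻ z, ENNReal.ofReal |η z.1 - g z.1| ∂μ :=
    lintegral_sampleQueryMeasure_query μ n (F := fun z => ENNReal.ofReal |η z.1 - g z.1|)
      (hηg.comp measurable_fst)
  refine (lintegral_mono hpt').trans ?_
  rw [lintegral_add_left hm1, lintegral_add_left hm2, lintegral_add_left hm3, hlast]
  have hm0 : (0 : ℝ) ≤ m := Nat.cast_nonneg m
  calc _ ≤ ENNReal.ofReal (ε / 4) + (m * ENNReal.ofReal (ε / (4 * (m + 1)))
        + ((ENNReal.ofReal (ε / 4) + ENNReal.ofReal (ε / 4))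
        + ENNReal.ofReal (ε / (4 * (m + 1))))) := by
        refine add_le_add ?_ (add_le_add ?_ (add_le_add ?_ hgη'))
        · exact (lintegral_abs_sum_residual_le h hk₀ hkle ρ hu (by positivity)).trans
            (ENNReal.ofReal_le_ofReal hnoise)
        · exact (lintegral_sum_knnWeight_mul_le (hm ρ hρ n (k n) u hu) hηg).trans (by gcongr)
        · exact (lintegral_sum_knnWeight_mul_abs_sub_le hc hC hB' hosc' hk₀ hkle
            hρ hu).trans (by gcongr)
    _ = ENNReal.ofReal ε := by
        rw [← ENNReal.ofReal_natCast, ← ENNReal.ofReal_mul hm0, ← ENNReal.ofReal_add,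
          ← ENNReal.ofReal_add, ← ENNReal.ofReal_add, ← ENNReal.ofReal_add]
        · congr 1; field_simp; ring
        all_goals positivity

/-- The error of the `k` nearest neighbour rule exceeds the Bayes error by little, uniformly over
the seminorms with given constants of equivalence and over all systems of distinct tie-breakers. -/
theorem eventually_measure_knnClassifier_ne_le {c C : ℝ} (hc : 0 < c) (hC : 0 < C) {k : ℕ → ℕ}
    (hk : Tendsto k atTop atTop)
    (hkn : Tendsto (fun n => (k n : ℝ) / (n : ℝ)) atTop (𝓝 0)) {ε : ℝ} (hε : 0 < ε) :
    ∀ᶠ n in atTop, ∀ ρ : Seminorm ℝ (Fin d → ℝ), (∀ x, c * ‖x‖ ≤ ρ x ∧ ρ x ≤ C * ‖x‖) →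
      ∀ u : Fin n → ℝ, Function.Injective u →
        sampleQueryMeasure μ n {p | knnClassifier (k n) ρ u p.1 p.2.1 ≠ p.2.2}
          ≤ ENNReal.ofReal (bayesError μ + ε) := by
  obtain ⟨η, h⟩ := exists_isRegressionFunction μ
  filter_upwards [eventually_lintegral_abs_knnRegression_sub_le h hc hC hk hkn (half_pos hε)] with
    n ⟨⟨hk₀, hkle⟩, hn⟩ ρ hρ u hu
  have hreg : Measurable fun p : (Fin n → (Fin d → ℝ) × Fin 2) × ((Fin d → ℝ) × Fin 2) =>
      knnRegression (k n) ρ u p.1 p.2.1 :=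
    measurable_knnRegression (fun _ => measurable_const) measurable_const measurable_fst
      (measurable_fst.comp measurable_snd)
  have hset : MeasurableSet {p : (Fin n → (Fin d → ℝ) × Fin 2) × ((Fin d → ℝ) × Fin 2) |
      knnClassifier (k n) ρ u p.1 p.2.1 ≠ p.2.2} :=
    (measurableSet_eq_fun (measurable_knnClassifier (fun _ => measurable_const) measurable_const
      measurable_fst (measurable_fst.comp measurable_snd))
      (measurable_snd.comp measurable_snd)).compl
  have hdiff : Measurable fun p : (Fin n → (Fin d → ℝ) × Fin 2) × ((Fin d → ℝ) × Fin 2) =>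
      ENNReal.ofReal |knnRegression (k n) ρ u p.1 p.2.1 - η p.2.1| :=
    (hreg.sub (h.measurable.comp (measurable_fst.comp measurable_snd))).abs.ennreal_ofReal
  have hD : ∀ D : Fin n → (Fin d → ℝ) × Fin 2,
      μ {q | knnClassifier (k n) ρ u D q.1 ≠ q.2} ≤ ENNReal.ofReal (bayesError μ)
        + 2 * ∫⁻ q, ENNReal.ofReal |knnRegression (k n) ρ u D q.1 - η q.1| ∂μ := fun D => by
    have hf : Measurable fun x => knnRegression (k n) ρ u D x :=
      measurable_knnRegression (fun _ => measurable_const) measurable_const measurable_const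
        measurable_id
    have hB : ∀ x, |knnRegression (k n) ρ u D x| ≤ 1 := fun x => by
      unfold knnRegression
      rw [abs_of_nonneg (Finset.sum_nonneg fun i _ =>
        mul_nonneg (label_nonneg _) (knnWeight_nonneg i)),
        ← sum_knnWeight (ρ := ρ) (xs := fun j => (D j).1) (x := x) hu hk₀ hkle]
      exact Finset.sum_le_sum fun i _ =>
        mul_le_of_le_one_left (knnWeight_nonneg i) (label_le_one _)
    have hplug := h.misclassificationError_plugin_le hf hB
    have hI : Integrable (fun q : (Fin d → ℝ) × Fin 2 =>
        |knnRegression (k n) ρ u D q.1 - η q.1|) μ := by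
      refine Integrable.of_bound (C := 1 + 1) ((hf.sub h.measurable).comp
        measurable_fst).abs.aestronglyMeasurable (Eventually.of_forall fun q => ?_)
      rw [Real.norm_eq_abs, abs_abs]
      refine (abs_sub _ _).trans (add_le_add (hB _) ?_)
      rw [abs_of_nonneg (h.nonneg _)]; exact h.le_one _
    rw [← ofReal_integral_eq_lintegral_ofReal hI (Eventually.of_forall fun _ => abs_nonneg _),
      ← ENNReal.ofReal_ofNat 2, ← ENNReal.ofReal_mul zero_le_two,
      ← ENNReal.ofReal_add (bayesError_nonneg μ)
        (mul_nonneg zero_le_two (integral_nonneg fun _ => abs_nonneg _)),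
      ← ofReal_measureReal]
    exact ENNReal.ofReal_le_ofReal hplug
  calc _ = ∫⁻ D, μ {q | knnClassifier (k n) ρ u D q.1 ≠ q.2} ∂(Measure.pi fun _ : Fin n => μ) :=
        Measure.prod_apply hset
    _ ≤ ∫⁻ D, (ENNReal.ofReal (bayesError μ)
        + 2 * ∫⁻ q, ENNReal.ofReal |knnRegression (k n) ρ u D q.1 - η q.1| ∂μ)
          ∂(Measure.pi fun _ : Fin n => μ) := lintegral_mono hD
    _ = ENNReal.ofReal (bayesError μ) + 2 * ∫⁻ p, ENNReal.ofReal
        |knnRegression (k n) ρ u p.1 p.2.1 - η p.2.1| ∂(sampleQueryMeasure μ n) := by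
        rw [lintegral_add_left measurable_const, lintegral_const_mul _ hdiff.lintegral_prod_right',
          lintegral_prod _ hdiff.aemeasurable]
        simp
    _ ≤ ENNReal.ofReal (bayesError μ) + 2 * ENNReal.ofReal (ε / 2) := by
        gcongr
        exact hn ρ hρ u hu
    _ = ENNReal.ofReal (bayesError μ + ε) := by
        rw [← ENNReal.ofReal_ofNat 2, ← ENNReal.ofReal_mul zero_le_two,
          ← ENNReal.ofReal_add (bayesError_nonneg μ) (by positivity)]
        congr 1; ring

end Consistency

/-! ### Random norms and tie-breakers -/

/-- The σ-algebra on seminorms that is generated by the evaluations at points. -/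
instance seminormMeasurableSpace (d : ℕ) : MeasurableSpace (Seminorm ℝ (Fin d → ℝ)) :=
  MeasurableSpace.comap (fun ρ x => ρ x) MeasurableSpace.pi

theorem measurable_seminorm_eval {d : ℕ} (x : Fin d → ℝ) :
    Measurable fun ρ : Seminorm ℝ (Fin d → ℝ) => ρ x :=
  (measurable_pi_apply x).comp
    (comap_measurable fun (ρ : Seminorm ℝ (Fin d → ℝ)) (x : Fin d → ℝ) => ρ x)

theorem measurable_of_measurable_eval {d : ℕ} {Ω : Type*} [MeasurableSpace Ω]
    {ρ : Ω → Seminorm ℝ (Fin d → ℝ)} (h : ∀ x, Measurable fun ω => ρ ω x) : Measurable ρ :=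
  measurable_comap_iff.2 (measurable_pi_lambda _ h)

theorem indepFun_seminorm_of_indepFun_eval {d : ℕ} {Ω α β : Type*} [MeasurableSpace Ω]
    [MeasurableSpace α] [MeasurableSpace β] {P : Measure Ω} {ρ : Ω → Seminorm ℝ (Fin d → ℝ)}
    {U : Ω → α} {X : Ω → β}
    (h : IndepFun (fun ω => ((fun x => ρ ω x : (Fin d → ℝ) → ℝ), U ω)) X P) :
    IndepFun (fun ω => (ρ ω, U ω)) X P := by
  rw [IndepFun_iff_Indep] at h ⊢
  convert h using 1
  change MeasurableSpace.comap _ (MeasurableSpace.prod _ _)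
    = MeasurableSpace.comap _ (MeasurableSpace.prod _ _)
  rw [MeasurableSpace.comap_prodMk, MeasurableSpace.comap_prodMk]
  congr 1
  exact MeasurableSpace.comap_comp

theorem ae_ne_of_indepFun {Ω : Type*} [MeasurableSpace Ω] {P : Measure Ω} [IsProbabilityMeasure P]
    {X Y : Ω → ℝ} (hX : Measurable X) (hY : Measurable Y) (h : IndepFun X Y P)
    [NullSingletonClass (P.map Y)] : ∀ᵐ ω ∂P, X ω ≠ Y ω := by
  have hmap := (indepFun_iff_map_prod_eq_prod_map_map hX.aemeasurable hY.aemeasurable).1 h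
  have hdiag : MeasurableSet {p : ℝ × ℝ | p.1 = p.2} :=
    measurableSet_eq_fun measurable_fst measurable_snd
  have h0 : ((P.map X).prod (P.map Y)) {p : ℝ × ℝ | p.1 = p.2} = 0 := by
    rw [Measure.measure_prod_null hdiag]
    refine Eventually.of_forall fun x => ?_
    have : Prod.mk x ⁻¹' {p : ℝ × ℝ | p.1 = p.2} = {x} := by ext y; simp [eq_comm]
    simp only [this, measure_singleton, Pi.zero_apply]
  rw [← hmap, Measure.map_apply (hX.prodMk hY) hdiag] at h0
  rw [ae_iff]
  simpa using h0

theorem ae_injective_of_iIndepFun {Ω : Type*} [MeasurableSpace Ω] {P : Measure Ω}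
    [IsProbabilityMeasure P] {T : ℕ → Ω → ℝ} (hT : ∀ i, Measurable (T i)) (h : iIndepFun T P)
    (hatom : ∀ i, NullSingletonClass (P.map (T i))) :
    ∀ᵐ ω ∂P, Function.Injective fun i => T i ω := by
  have h1 : ∀ᵐ ω ∂P, ∀ i j, i ≠ j → T i ω ≠ T j ω := by
    rw [ae_all_iff]; intro i
    rw [ae_all_iff]; intro j
    by_cases hij : i = j
    · simp [hij]
    have := hatom j
    filter_upwards [ae_ne_of_indepFun (hT i) (hT j) (h.indepFun hij)] with ω hω _ using hω
  filter_upwards [h1] with ω hω i j hij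
  by_contra hne
  exact hω i j hne hij

/-! ### Bounds for the error probabilities -/

section Error

variable {d : ℕ} {μ : Measure ((Fin d → ℝ) × Fin 2)} [IsProbabilityMeasure μ]

theorem measurableSet_knnClassifier_ne (k n : ℕ) :
    MeasurableSet {s : (Seminorm ℝ (Fin d → ℝ) × (Fin n → ℝ)) ×
      ((Fin n → (Fin d → ℝ) × Fin 2) × ((Fin d → ℝ) × Fin 2)) |
        knnClassifier k s.1.1 s.1.2 s.2.1 s.2.2.1 ≠ s.2.2.2} := by
  have hq : Measurable fun s : (Seminorm ℝ (Fin d → ℝ) × (Fin n → ℝ)) ×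
      ((Fin n → (Fin d → ℝ) × Fin 2) × ((Fin d → ℝ) × Fin 2)) => s.2.2 :=
    measurable_snd.comp measurable_snd
  exact (measurableSet_eq_fun (measurable_knnClassifier
    (fun y => (measurable_seminorm_eval y).comp (measurable_fst.comp measurable_fst))
    (measurable_snd.comp measurable_fst) (measurable_fst.comp measurable_snd)
    (measurable_fst.comp hq)) (measurable_snd.comp hq)).compl

variable {Ω : Type*} [MeasurableSpace Ω] {P : Measure Ω} [IsProbabilityMeasure P] {n : ℕ}
  {V : Ω → Seminorm ℝ (Fin d → ℝ) × (Fin n → ℝ)} {D : Ω → Fin n → (Fin d → ℝ) × Fin 2}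
  {Q : Ω → (Fin d → ℝ) × Fin 2}

/-- Fubini: the law of the norm and the tie-breakers can be integrated last. -/
theorem measure_setOf_eq_lintegral (hV : Measurable V) (hD : Measurable D) (hQ : Measurable Q)
    (hlaw : P.map (fun ω => (D ω, Q ω)) = sampleQueryMeasure μ n)
    (hind : IndepFun V (fun ω => (D ω, Q ω)) P)
    {B : Set ((Seminorm ℝ (Fin d → ℝ) × (Fin n → ℝ)) ×
      ((Fin n → (Fin d → ℝ) × Fin 2) × ((Fin d → ℝ) × Fin 2)))} (hB : MeasurableSet B) :
    P {ω | (V ω, (D ω, Q ω)) ∈ B}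
      = ∫⁻ ω, sampleQueryMeasure μ n {p | (V ω, p) ∈ B} ∂P := by
  have hDQ : Measurable fun ω => (D ω, Q ω) := hD.prodMk hQ
  have hmap := (indepFun_iff_map_prod_eq_prod_map_map hV.aemeasurable hDQ.aemeasurable).1 hind
  have h1 : P {ω | (V ω, (D ω, Q ω)) ∈ B} = (P.map fun ω => (V ω, (D ω, Q ω))) B :=
    (Measure.map_apply (hV.prodMk hDQ) hB).symm
  rw [h1, hmap, hlaw, Measure.prod_apply hB, lintegral_map (measurable_measure_prodMk_left hB) hV]
  rfl

/-- On every event determined by the sample, the probability of a wrong prediction is at least the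
Bayes error times the probability of the event: given the sample, the norm and the tie-breakers,
the prediction is a fixed classifier evaluated at an independent query. -/
theorem bayesError_mul_le (k : ℕ) (hV : Measurable V) (hD : Measurable D) (hQ : Measurable Q)
    (hlaw : P.map (fun ω => (D ω, Q ω)) = sampleQueryMeasure μ n)
    (hind : IndepFun V (fun ω => (D ω, Q ω)) P) {A : Set (Fin n → (Fin d → ℝ) × Fin 2)}
    (hA : MeasurableSet A) :
    bayesError μ * P.real (D ⁻¹' A)
      ≤ P.real (D ⁻¹' A ∩ {ω | knnClassifier k (V ω).1 (V ω).2 (D ω) (Q ω).1 ≠ (Q ω).2}) := by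
  have hB := ((measurable_fst.comp measurable_snd) hA).inter
    (measurableSet_knnClassifier_ne (d := d) k n)
  have hPA : P (D ⁻¹' A) = (Measure.pi fun _ => μ) A := by
    have h1 : P (D ⁻¹' A) = (P.map fun ω => (D ω, Q ω)) (Prod.fst ⁻¹' A) :=
      (Measure.map_apply (hD.prodMk hQ) (measurable_fst hA)).symm
    rw [h1, hlaw, ← Set.prod_univ, Measure.prod_prod, measure_univ, mul_one]
  have hfix : ∀ s : Seminorm ℝ (Fin d → ℝ) × (Fin n → ℝ),
      ENNReal.ofReal (bayesError μ) * (Measure.pi fun _ => μ) A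
        ≤ sampleQueryMeasure μ n {p | p.1 ∈ A ∧ knnClassifier k s.1 s.2 p.1 p.2.1 ≠ p.2.2} :=
    fun s => by
      have hs : MeasurableSet {p : (Fin n → (Fin d → ℝ) × Fin 2) × ((Fin d → ℝ) × Fin 2) |
          p.1 ∈ A ∧ knnClassifier k s.1 s.2 p.1 p.2.1 ≠ p.2.2} := measurable_prodMk_left hB
      rw [Measure.prod_apply hs, ← lintegral_indicator_const hA]
      refine lintegral_mono fun D => ?_
      by_cases hDA : D ∈ A
      · have hg : Measurable fun x => knnClassifier k s.1 s.2 D x :=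
          measurable_knnClassifier (fun _ => measurable_const) measurable_const measurable_const
            measurable_id
        rw [Set.indicator_of_mem hDA]
        refine (ENNReal.ofReal_le_ofReal (bayesError_le (μ := μ) hg)).trans ?_
        rw [misclassificationError, ofReal_measureReal]
        exact measure_mono fun q hq => ⟨hDA, hq⟩
      · rw [Set.indicator_of_notMem hDA]
        exact zero_le
  have hmain : ENNReal.ofReal (bayesError μ) * P (D ⁻¹' A)
      ≤ P (D ⁻¹' A ∩ {ω | knnClassifier k (V ω).1 (V ω).2 (D ω) (Q ω).1 ≠ (Q ω).2}) := by
    have h1 := measure_setOf_eq_lintegral (μ := μ) hV hD hQ hlaw hind hB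
    calc _ = ∫⁻ _, ENNReal.ofReal (bayesError μ) * (Measure.pi fun _ => μ) A ∂P := by
          rw [hPA]; simp
      _ ≤ _ := lintegral_mono fun ω => hfix (V ω)
      _ = _ := h1.symm
  have h2 := ENNReal.toReal_mono (measure_ne_top _ _) hmain
  rwa [ENNReal.toReal_mul, ENNReal.toReal_ofReal (bayesError_nonneg μ)] at h2

theorem measurableSet_error (k : ℕ) (hV : Measurable V) (hD : Measurable D) (hQ : Measurable Q) :
    MeasurableSet {ω | knnClassifier k (V ω).1 (V ω).2 (D ω) (Q ω).1 ≠ (Q ω).2} :=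
  (hV.prodMk (hD.prodMk hQ)) (measurableSet_knnClassifier_ne k n)

/-- The conditional error probability given the sample is almost surely at least the Bayes error. -/
theorem bayesError_le_condExp (k : ℕ) (hV : Measurable V) (hD : Measurable D) (hQ : Measurable Q)
    (hlaw : P.map (fun ω => (D ω, Q ω)) = sampleQueryMeasure μ n)
    (hind : IndepFun V (fun ω => (D ω, Q ω)) P) :
    (fun _ => bayesError μ) ≤ᵐ[P]
      P[{ω | knnClassifier k (V ω).1 (V ω).2 (D ω) (Q ω).1 ≠ (Q ω).2}.indicator
        (fun _ => (1 : ℝ)) | MeasurableSpace.comap D inferInstance] := by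
  set Err := {ω | knnClassifier k (V ω).1 (V ω).2 (D ω) (Q ω).1 ≠ (Q ω).2} with hErr
  have hErrm : MeasurableSet Err := measurableSet_error k hV hD hQ
  have hm : MeasurableSpace.comap D inferInstance ≤ (inferInstance : MeasurableSpace Ω) :=
    hD.comap_le
  have hint : Integrable (Err.indicator fun _ => (1 : ℝ)) P :=
    (integrable_const _).indicator hErrm
  refine ae_le_of_ae_le_trim (hm := hm) ?_
  refine ae_le_of_forall_setIntegral_le (integrable_const _)
    (integrable_condExp.trim hm stronglyMeasurable_condExp) fun s hs _ => ?_
  rw [← setIntegral_trim hm stronglyMeasurable_condExp hs, setIntegral_condExp hm hint hs,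
    ← setIntegral_trim hm stronglyMeasurable_const hs]
  obtain ⟨A, hA, rfl⟩ := hs
  have h1 := bayesError_mul_le k hV hD hQ hlaw hind hA
  rw [setIntegral_indicator hErrm]
  simpa [mul_comm] using h1

theorem measureReal_error_le (k : ℕ) (hV : Measurable V) (hD : Measurable D) (hQ : Measurable Q)
    (hlaw : P.map (fun ω => (D ω, Q ω)) = sampleQueryMeasure μ n)
    (hind : IndepFun V (fun ω => (D ω, Q ω)) P) {b : ℝ} (hb : 0 ≤ b)
    (h : ∀ᵐ ω ∂P, sampleQueryMeasure μ n
      {p | knnClassifier k (V ω).1 (V ω).2 p.1 p.2.1 ≠ p.2.2} ≤ ENNReal.ofReal b) :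
    P.real {ω | knnClassifier k (V ω).1 (V ω).2 (D ω) (Q ω).1 ≠ (Q ω).2} ≤ b := by
  have h1 := measure_setOf_eq_lintegral (μ := μ) hV hD hQ hlaw hind
    (measurableSet_knnClassifier_ne (d := d) k n)
  refine ENNReal.toReal_le_of_le_ofReal hb ?_
  calc _ = _ := h1
    _ ≤ ∫⁻ _, ENNReal.ofReal b ∂P := lintegral_mono_ae h
    _ = ENNReal.ofReal b := by simp

end Error

/-- A sequence of conditional probabilities that are bounded below by a constant converges to it in
probability as soon as their means converge to it. -/
theorem tendstoInMeasure_condExp_indicator {Ω : Type*} [mΩ : MeasurableSpace Ω] {P : Measure Ω}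
    [IsProbabilityMeasure P] {m : ℕ → MeasurableSpace Ω} (hm : ∀ n, m n ≤ mΩ) {A : ℕ → Set Ω}
    (hA : ∀ n, MeasurableSet (A n)) {b : ℝ}
    (hb : ∀ n, (fun _ => b) ≤ᵐ[P] P[(A n).indicator (fun _ => (1 : ℝ)) | m n])
    (hlim : Tendsto (fun n => P.real (A n)) atTop (𝓝 b)) :
    TendstoInMeasure P (fun n => P[(A n).indicator (fun _ => (1 : ℝ)) | m n]) atTop
      (fun _ => b) := by
  refine tendstoInMeasure_of_tendsto_eLpNorm one_ne_zero
    (fun n => integrable_condExp.aestronglyMeasurable) aestronglyMeasurable_const ?_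
  have hnorm : ∀ n, eLpNorm (P[(A n).indicator (fun _ => (1 : ℝ)) | m n] - fun _ => b) 1 P
      = ENNReal.ofReal (P.real (A n) - b) := fun n => by
    have hI : Integrable (P[(A n).indicator (fun _ => (1 : ℝ)) | m n] - fun _ => b) P :=
      integrable_condExp.sub (integrable_const b)
    rw [eLpNorm_one_eq_lintegral_enorm, ← ofReal_integral_norm_eq_lintegral_enorm hI]
    congr 1
    calc ∫ ω, ‖P[(A n).indicator (fun _ => (1 : ℝ)) | m n] ω - b‖ ∂P
        = ∫ ω, (P[(A n).indicator (fun _ => (1 : ℝ)) | m n] ω - b) ∂P := by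
          refine integral_congr_ae ?_
          filter_upwards [hb n] with ω hω
          exact Real.norm_of_nonneg (sub_nonneg.2 hω)
      _ = P.real (A n) - b := by
          rw [integral_sub integrable_condExp (integrable_const b), integral_condExp (hm n),
            integral_indicator (hA n)]
          simp
  simp_rw [hnorm]
  have h0 : Tendsto (fun n => P.real (A n) - b) atTop (𝓝 0) := by
    simpa using hlim.sub_const b
  simpa using ENNReal.tendsto_ofReal h0

end KNN

end

theorem mainTheorem1 {d : ℕ}
    -- a family of norms sandwiched between two norms
    (𝒩 : Set (Seminorm ℝ (Fin d → ℝ))) (h𝒩 : ∀ ρ ∈ 𝒩, KNN.IsNorm ρ)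
    (hsandwich : ∃ L U : Seminorm ℝ (Fin d → ℝ),
      KNN.IsNorm L ∧ KNN.IsNorm U ∧ ∀ ρ ∈ 𝒩, L ≤ ρ ∧ ρ ≤ U)
    -- the number of neighbours
    (k : ℕ → ℕ) (hk : Tendsto k atTop atTop)
    (hkn : Tendsto (fun n => (k n : ℝ) / (n : ℝ)) atTop (𝓝 0))
    {Ω : Type*} [MeasurableSpace Ω] (P : Measure Ω) [IsProbabilityMeasure P]
    -- an arbitrary distribution of (point, label), an iid labelled sample from it, and an
    -- independent query with its label
    (μ : Measure ((Fin d → ℝ) × Fin 2)) [IsProbabilityMeasure μ]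
    (Z : ℕ → Ω → (Fin d → ℝ) × Fin 2) (Q : Ω → (Fin d → ℝ) × Fin 2)
    (hZ : ∀ i, Measurable (Z i)) (hQ : Measurable Q)
    (hZμ : ∀ i, P.map (Z i) = μ) (hQμ : P.map Q = μ)
    (hZindep : iIndepFun Z P) (hQindep : IndepFun (fun ω i => Z i ω) Q P)
    -- iid uniform tie-breakers
    (T : ℕ → Ω → ℝ) (hT : ∀ i, Measurable (T i))
    (hTunif : ∀ i, P.map (T i) = volume.restrict (Set.Icc (0 : ℝ) 1))
    (hTindep : iIndepFun T P)
    -- random norms in the family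
    (ρ : ℕ → Ω → Seminorm ℝ (Fin d → ℝ)) (hρ : ∀ n ω, ρ n ω ∈ 𝒩)
    (hρmeas : ∀ n x, Measurable (fun ω => ρ n ω x))
    -- for each sample size, the norm together with the tie-breakers is independent of the sample
    -- together with the query
    (hindep : ∀ n : ℕ, IndepFun
      (fun ω => ((fun x => ρ n ω x : (Fin d → ℝ) → ℝ), (fun i : Fin n => T i ω)))
      (fun ω => ((fun i : Fin n => Z i ω), Q ω)) P) :
    KNN.IsConsistent P μ (fun n ω (i : Fin n) => Z i ω) Q
      (fun n ω => KNN.knnClassifier (k n) (ρ n ω) (fun i : Fin n => T i ω)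
        (fun i : Fin n => Z i ω) (Q ω).1) := by
  obtain ⟨c, C, hc, hC, hcC⟩ := KNN.exists_norm_equiv hsandwich
  have hDm : ∀ n : ℕ, Measurable fun ω (i : Fin n) => Z i ω := fun n =>
    measurable_pi_lambda _ fun i => hZ i
  have hVm : ∀ n : ℕ, Measurable fun ω => (ρ n ω, fun i : Fin n => T i ω) := fun n =>
    (KNN.measurable_of_measurable_eval (hρmeas n)).prodMk (measurable_pi_lambda _ fun i => hT i)
  have hind : ∀ n : ℕ, IndepFun (fun ω => (ρ n ω, fun i : Fin n => T i ω))
      (fun ω => ((fun i : Fin n => Z i ω), Q ω)) P := fun n =>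
    KNN.indepFun_seminorm_of_indepFun_eval (hindep n)
  have hlaw : ∀ n : ℕ, P.map (fun ω => ((fun i : Fin n => Z i ω), Q ω))
      = KNN.sampleQueryMeasure μ n := fun n => by
    have h1 : IndepFun (fun ω (i : Fin n) => Z i ω) Q P :=
      hQindep.comp (φ := fun (z : ℕ → (Fin d → ℝ) × Fin 2) (i : Fin n) => z i)
        (measurable_pi_lambda _ fun i => measurable_pi_apply _) measurable_id
    have h2 : P.map (fun ω (i : Fin n) => Z i ω) = Measure.pi fun _ => μ := by
      rw [(iIndepFun_iff_map_fun_eq_pi_map fun i : Fin n => (hZ i).aemeasurable).1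
        (hZindep.precomp Fin.val_injective)]
      simp [hZμ]
    rw [(indepFun_iff_map_prod_eq_prod_map_map (hDm n).aemeasurable hQ.aemeasurable).1 h1, h2,
      hQμ]
  have hinj : ∀ᵐ ω ∂P, Function.Injective fun i => T i ω :=
    KNN.ae_injective_of_iIndepFun hT hTindep fun i => by rw [hTunif i]; infer_instance
  have hlower : ∀ n, KNN.bayesError μ ≤ P.real {ω | KNN.knnClassifier (k n) (ρ n ω)
      (fun i : Fin n => T i ω) (fun i : Fin n => Z i ω) (Q ω).1 ≠ (Q ω).2} := fun n => by
    simpa using KNN.bayesError_mul_le (k n) (hVm n) (hDm n) hQ (hlaw n) (hind n)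
      MeasurableSet.univ
  have hlim : Tendsto (fun n => P.real {ω | KNN.knnClassifier (k n) (ρ n ω)
      (fun i : Fin n => T i ω) (fun i : Fin n => Z i ω) (Q ω).1 ≠ (Q ω).2}) atTop
      (𝓝 (KNN.bayesError μ)) := by
    refine tendsto_order.2 ⟨fun a ha => Eventually.of_forall fun n => ha.trans_le (hlower n),
      fun a ha => ?_⟩
    have hε : 0 < (a - KNN.bayesError μ) / 2 := by linarith
    filter_upwards [KNN.eventually_measure_knnClassifier_ne_le (μ := μ) hc hC hk hkn hε] with n hn
    refine (KNN.measureReal_error_le (k n) (hVm n) (hDm n) hQ (hlaw n) (hind n)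
      (b := KNN.bayesError μ + (a - KNN.bayesError μ) / 2)
      (add_nonneg (KNN.bayesError_nonneg μ) hε.le) ?_).trans_lt (by linarith)
    filter_upwards [hinj] with ω hω
    exact hn (ρ n ω) (hcC _ (hρ n ω)) _ (hω.comp Fin.val_injective)
  exact ⟨KNN.tendstoInMeasure_condExp_indicator (fun n => (hDm n).comap_le)
    (fun n => KNN.measurableSet_error (k n) (hVm n) (hDm n) hQ)
    (fun n => KNN.bayesError_le_condExp (k n) (hVm n) (hDm n) hQ (hlaw n) (hind n)) hlim, hlim⟩
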